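/- Let $\rho,r,\eta,\xi,p,T>0$, $\theta\in(0,1)$, $a_0\ge 0$, $x_0\in[0,1]$, and let $w\in C^2(\mathbb R)$ be bounded with bounded derivative, $w>0$ on $(0,1)$, $w<0$ outside $[0,1]$, $w'>0$ on $(-\infty,0]$ and $w'<0$ on $[1,\infty)$. Put $\mu=\max_{t,t_0\in[0,T]}e^{(r-\rho)(t-t_0)}$ and let $C,Z$ be constants with $$C>\max\bigl(1,\mu^{1/\theta}\bigr)\,\frac{a_0+T\sup_x|w(x)|}{p\,\frac{1-e^{-rT}}{r}},\qquad Z>\frac{T\,\sup_x|w'(x)|\,e^{rT}}{2\xi}.$$ Consider the problem of maximizing $$J(c,z)=\int_0^T e^{-\rho t}\Bigl(\frac{c(t)^{1-\theta}}{1-\theta}-\eta z(t)^2\Bigr)dt+e^{-\rho T}\frac{a(T)^{1-\theta}}{1-\theta}$$ over measurable controls $c,z$ on $[0,T]$ with $0\le c\le C$, $|z|\le Z$, whose absolutely continuous trajectory, given by $\dot a=ra+w(x)-pc-\xi z^2$, $\dot x=z$ a.e., $a(0)=a_0$, $x(0)=x_0$, satisfies $a(T)\ge 0$. Let $$H(t,a,x,\varphi,\psi,p_1,p_2)=p_1(ra+w(x)-p\varphi-\xi\psi^2)+p_2\psi+\lambda_0e^{-\rho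 t}\Bigl(\frac{\varphi^{1-\theta}}{1-\theta}-\eta\psi^2\Bigr).$$ Call $(\lambda_0,p_1,p_2)$, with $\lambda_0\in\{0,1\}$ and $p_1,p_2$ absolutely continuous on $[0,T]$, multipliers for a process $(c,z,a,x)$ if $\dot p_1=-rp_1$ and $\dot p_2=-p_1w'(x)$ a.e.; for a.e. $t$ the pair $(c(t),z(t))$ maximizes $(\varphi,\psi)\mapsto H(t,a(t),x(t),\varphi,\psi,p_1(t),p_2(t))$ over $[0,C]\times[-Z,Z]$; $p_1(T)=\lambda_0e^{-\rho T}a(T)^{-\theta}$, $p_2(T)=0$; and $\lambda_0,p_1,p_2$ do not all vanish identically. Let $(c,z)$ be an optimal pair of controls with trajectory $(a,x)$. Then multipliers $(\lambda_0,p_1,p_2)$ exist, and for every choice of multipliers, with $\lambda_1:=p_1(0)$, one has $\lambda_1>0$, the identity $$\Bigl[\frac1{p\lambda_1}\Bigr]^{1/\theta}e^{\frac{r-\rho}{\theta}t}=\frac1{p^{1/\theta}}e^{\frac{\rho-r}{\theta}(T-t)}a(T)\in(0,C)\qquad\text{for every }t\in[0,T],$$ and $c(t)\in(0,C)$ is equal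 to this common value for almost every $t\in[0,T]$ (so that, after modification on a null set, for every $t\in[0,T]$). -/

import Mathlib

open MeasureTheory Set

noncomputable section

/-- The data of the model: discount rate `ρ`, interest rate `r`, disutility of relocation `η`,
monetary relocation cost `ξ`, price of consumption `p`, utility parameter `θ`, horizon `T`,
initial assets `a₀`, initial location `x₀`, bounds `C`, `Z` on the controls, and the
location-dependent wage `w`. -/
structure RelocationModel where
  ρ : ℝ
  r : ℝ
  η : ℝ
  ξ : ℝ
  p : ℝ
  θ : ℝ
  T : ℝ
  a₀ : ℝ
  x₀ : ℝ
  C : ℝ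
  Z : ℝ
  w : ℝ → ℝ

namespace RelocationModel

/-- `μ`, the maximum over `t, t₀ ∈ [0,T]` of `exp ((r - ρ) (t - t₀))`. -/
def mu (M : RelocationModel) : ℝ :=
  sSup ((fun q : ℝ × ℝ => Real.exp ((M.r - M.ρ) * (q.1 - q.2))) '' (Icc 0 M.T ×ˢ Icc 0 M.T))

/-- The assumptions on the parameters, on the wage and on the control bounds. -/
structure Standing (M : RelocationModel) : Prop where
  ρ_pos : 0 < M.ρ
  r_pos : 0 < M.r
  η_pos : 0 < M.η
  ξ_pos : 0 < M.ξ
  p_pos : 0 < M.p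
  θ_mem : M.θ ∈ Ioo (0 : ℝ) 1
  T_pos : 0 < M.T
  a₀_nonneg : 0 ≤ M.a₀
  x₀_mem : M.x₀ ∈ Icc (0 : ℝ) 1
  w_smooth : ContDiff ℝ 2 M.w
  w_bdd : BddAbove (range fun x => |M.w x|)
  w'_bdd : BddAbove (range fun x => |deriv M.w x|)
  w_pos : ∀ x ∈ Ioo (0 : ℝ) 1, 0 < M.w x
  w_neg : ∀ x, x ∉ Icc (0 : ℝ) 1 → M.w x < 0
  w'_pos : ∀ x ≤ (0 : ℝ), 0 < deriv M.w x
  w'_neg : ∀ x ≥ (1 : ℝ), deriv M.w x < 0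
  C_large : max 1 (M.mu ^ (1 / M.θ)) *
    ((M.a₀ + M.T * ⨆ x, |M.w x|) / (M.p * ((1 - Real.exp (-M.r * M.T)) / M.r))) < M.C
  Z_large : M.T * (⨆ x, |deriv M.w x|) * Real.exp (M.r * M.T) / (2 * M.ξ) < M.Z

/-- `(c, z)` is a pair of admissible controls and `(a, x)` is the corresponding trajectory
(all functions matter on `[0,T]` only). -/
structure IsAdmissible (M : RelocationModel) (c z a x : ℝ → ℝ) : Prop where
  c_meas : AEMeasurable c (volume.restrict (Icc 0 M.T))
  z_meas : AEMeasurable z (volume.restrict (Icc 0 M.T))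
  c_mem : ∀ t ∈ Icc 0 M.T, c t ∈ Icc 0 M.C
  z_mem : ∀ t ∈ Icc 0 M.T, |z t| ≤ M.Z
  a_ac : AbsolutelyContinuousOnInterval a 0 M.T
  x_ac : AbsolutelyContinuousOnInterval x 0 M.T
  a_init : a 0 = M.a₀
  x_init : x 0 = M.x₀
  a_ode : ∀ᵐ t ∂(volume.restrict (Icc 0 M.T)),
    HasDerivAt a (M.r * a t + M.w (x t) - M.p * c t - M.ξ * z t ^ 2) t
  x_ode : ∀ᵐ t ∂(volume.restrict (Icc 0 M.T)), HasDerivAt x (z t) t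
  a_final : 0 ≤ a M.T

/-- The objective functional, for the controls `(c, z)` and the asset trajectory `a`. -/
def J (M : RelocationModel) (c z a : ℝ → ℝ) : ℝ :=
  (∫ t in (0 : ℝ)..M.T,
    Real.exp (-M.ρ * t) * (c t ^ (1 - M.θ) / (1 - M.θ) - M.η * z t ^ 2)) +
  Real.exp (-M.ρ * M.T) * (a M.T ^ (1 - M.θ) / (1 - M.θ))

/-- `(c, z)`, with trajectory `(a, x)`, solves the optimal control problem. -/
def IsOptimal (M : RelocationModel) (c z a x : ℝ → ℝ) : Prop :=
  M.IsAdmissible c z a x ∧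
    ∀ c' z' a' x' : ℝ → ℝ, M.IsAdmissible c' z' a' x' → M.J c' z' a' ≤ M.J c z a

/-- The Hamiltonian `H(t, a, x, φ, ψ, p₁, p₂)`, with cost multiplier `l₀`. -/
def hamiltonian (M : RelocationModel) (l₀ t a x φ ψ p₁ p₂ : ℝ) : ℝ :=
  p₁ * (M.r * a + M.w x - M.p * φ - M.ξ * ψ ^ 2) + p₂ * ψ +
    l₀ * Real.exp (-M.ρ * t) * (φ ^ (1 - M.θ) / (1 - M.θ) - M.η * ψ ^ 2)

/-- `(l₀, p₁, p₂)` are multipliers of Pontryagin's maximum principle along the process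
`(c, z, a, x)`. The number `p₁ 0` is the multiplier `λ₁`. -/
structure IsMultiplier (M : RelocationModel) (c z a x : ℝ → ℝ) (l₀ : ℝ) (p₁ p₂ : ℝ → ℝ) :
    Prop where
  l₀_mem : l₀ = 0 ∨ l₀ = 1
  p₁_ac : AbsolutelyContinuousOnInterval p₁ 0 M.T
  p₂_ac : AbsolutelyContinuousOnInterval p₂ 0 M.T
  p₁_ode : ∀ᵐ t ∂(volume.restrict (Icc 0 M.T)), HasDerivAt p₁ (-M.r * p₁ t) t
  p₂_ode : ∀ᵐ t ∂(volume.restrict (Icc 0 M.T)),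
    HasDerivAt p₂ (-(p₁ t) * deriv M.w (x t)) t
  maximum : ∀ᵐ t ∂(volume.restrict (Icc 0 M.T)), ∀ φ ∈ Icc 0 M.C, ∀ ψ ∈ Icc (-M.Z) M.Z,
    M.hamiltonian l₀ t (a t) (x t) φ ψ (p₁ t) (p₂ t) ≤
      M.hamiltonian l₀ t (a t) (x t) (c t) (z t) (p₁ t) (p₂ t)
  p₁_final : p₁ M.T = l₀ * Real.exp (-M.ρ * M.T) * a M.T ^ (-M.θ)
  p₂_final : p₂ M.T = 0
  nontrivial : ¬ (l₀ = 0 ∧ ∀ t ∈ Icc 0 M.T, p₁ t = 0 ∧ p₂ t = 0)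

/-- The closed form of the consumption rule in terms of the multiplier `l₁`. -/
def ruleMultiplier (M : RelocationModel) (l₁ t : ℝ) : ℝ :=
  (1 / (M.p * l₁)) ^ (1 / M.θ) * Real.exp ((M.r - M.ρ) / M.θ * t)

/-- The closed form of the consumption rule in terms of the terminal assets `aT`. -/
def ruleAssets (M : RelocationModel) (aT t : ℝ) : ℝ :=
  1 / M.p ^ (1 / M.θ) * Real.exp ((M.ρ - M.r) / M.θ * (M.T - t)) * aT

end RelocationModel

end

/-! The maximum principle is obtained from convex variations. Along the segment from the optimal
controls to any competitor, the payoff is concave and final wealth is at least its linear expansion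
minus `K * e ^ 2`. Since utility increases with wealth, these one-sided bounds suffice for
first-order conditions (`IsOptimalControl.exists_variation`).

Final wealth must be positive. At zero wealth marginal utility is infinite, so no direction may
raise wealth to first order; this forces `c = 0` a.e. and a nonpositive value. Doing nothing would
then be optimal with no final wealth, which requires `a₀ = 0` and `w x₀ = 0`. But then `x₀` is an
endpoint of `[0, 1]`, and moving slowly inward raises wealth.

With positive wealth, integration by parts against the location costate turns the first-order
condition into a nonpositive integral of Hamiltonian differences. Testing with the pointwise
maximizer gives the maximum condition.

Any multipliers have `l₀ = 1` and `p₁ 0` fixed by `a T`, so strict concavity gives `c` as the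
closed-form rule capped at `C`. The cap is never reached: the rule varies over time by a factor at
most `μ ^ (1 / θ)`, so touching `C` once would mean consuming more than all resources. -/

/-! ### One-variable inequalities: first-order conditions, concave powers, parabolas, Taylor bounds.
-/

open Filter Topology in
/-- A quantity whose value is at most its value at `0` for small positive parameters has
nonpositive derivative at `0`. -/
lemma hasDerivAt_nonpos_of_eventually_le {f : ℝ → ℝ} {d : ℝ} (hf : HasDerivAt f d 0)
    (h : ∀ᶠ e in 𝓝[>] (0 : ℝ), f e ≤ f 0) : d ≤ 0 := by
  have h1 : Tendsto (slope f 0) (𝓝[>] 0) (𝓝 d) :=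
    (hasDerivAt_iff_tendsto_slope.1 hf).mono_left
      (nhdsWithin_mono _ fun x hx => ne_of_gt hx)
  refine le_of_tendsto h1 ?_
  filter_upwards [h, self_mem_nhdsWithin] with e he he0
  rw [slope_def_field, sub_zero]
  exact div_nonpos_of_nonpos_of_nonneg (by linarith) (le_of_lt he0)

open Filter Topology in
/-- First order conditions for a one-parameter variation of a terminal power utility when the
initial level is positive. -/
lemma first_order_of_pos {θ W k D A K : ℝ} (hW : 0 < W)
    (h : ∀ e ∈ Icc (0 : ℝ) 1, 0 ≤ W + e * A - K * e ^ 2 →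
      e * D + k * (W + e * A - K * e ^ 2) ^ (1 - θ) ≤ k * W ^ (1 - θ)) :
    D + k * ((1 - θ) * W ^ (-θ) * A) ≤ 0 := by
  have hg : HasDerivAt (fun e : ℝ => W + e * A - K * e ^ 2) A 0 := by
    have := (((hasDerivAt_id (0 : ℝ)).mul_const A).const_add W).sub
      (((hasDerivAt_id (0 : ℝ)).pow 2).const_mul K)
    convert! this using 1
    simp
  have hf : HasDerivAt (fun e : ℝ => e * D + k * (W + e * A - K * e ^ 2) ^ (1 - θ))
      (D + k * ((1 - θ) * W ^ (-θ) * A)) 0 := by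
    have h1 := hg.rpow_const (p := 1 - θ) (Or.inl (by simpa using hW.ne'))
    have := ((hasDerivAt_id (0 : ℝ)).mul_const D).add (h1.const_mul k)
    convert! this using 1
    simp only [zero_mul, add_zero, ne_eq, OfNat.ofNat_ne_zero, not_false_eq_true, zero_pow,
      mul_zero, sub_zero, one_mul]
    rw [show (1 - θ - 1) = -θ by ring]
    ring
  refine hasDerivAt_nonpos_of_eventually_le hf ?_
  have hpos : ∀ᶠ e in 𝓝[>] (0 : ℝ), 0 < W + e * A - K * e ^ 2 := by
    refine nhdsWithin_le_nhds (hg.continuousAt.eventually (lt_mem_nhds ?_))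
    simpa using hW
  filter_upwards [hpos, Ioo_mem_nhdsGT (zero_lt_one' ℝ)] with e he he1
  simpa using h e ⟨he1.1.le, he1.2.le⟩ he.le

open Filter Topology in
/-- First order conditions for a one-parameter variation of a terminal power utility when the
initial level is zero: marginal utility is infinite there. -/
lemma first_order_of_zero {θ k D A K : ℝ} (hθ : θ ∈ Ioo (0 : ℝ) 1) (hk : 0 < k)
    (h : ∀ e ∈ Icc (0 : ℝ) 1, 0 ≤ e * A - K * e ^ 2 →
      e * D + k * (e * A - K * e ^ 2) ^ (1 - θ) ≤ 0) : A ≤ 0 := by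
  by_contra! hA
  have hsmall : ∀ᶠ e in 𝓝[>] (0 : ℝ), K * e < A / 2 := by
    have : Tendsto (fun e : ℝ => K * e) (𝓝 0) (𝓝 0) := by
      simpa using (continuous_const_mul K).tendsto 0
    exact nhdsWithin_le_nhds (this.eventually (gt_mem_nhds (by linarith)))
  -- For small `e` the level is at least `e * (A / 2)`. Dividing by `e ^ (1 - θ)` leaves `e ^ θ *
  -- D`, which tends to zero, against a fixed positive utility term.
  have hev : ∀ᶠ e in 𝓝[>] (0 : ℝ), e ^ θ * D + k * (A / 2) ^ (1 - θ) ≤ 0 := by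
    filter_upwards [hsmall, Ioo_mem_nhdsGT (zero_lt_one' ℝ)] with e he he1
    obtain ⟨he0, he1⟩ := he1
    have h2 : e * (A / 2) ≤ e * A - K * e ^ 2 := by nlinarith
    have h3 := h e ⟨he0.le, he1.le⟩ (le_trans (by positivity) h2)
    have h4 : (e * (A / 2)) ^ (1 - θ) ≤ (e * A - K * e ^ 2) ^ (1 - θ) :=
      Real.rpow_le_rpow (by positivity) h2 (by linarith [hθ.2])
    rw [Real.mul_rpow he0.le (by positivity)] at h4
    have h5 : e = e ^ (1 - θ) * e ^ θ := by
      rw [← Real.rpow_add he0]; simp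
    have h6 : 0 < e ^ (1 - θ) := Real.rpow_pos_of_pos he0 _
    have h7 : e ^ (1 - θ) * (e ^ θ * D + k * (A / 2) ^ (1 - θ)) ≤ 0 := by
      have h8 := mul_le_mul_of_nonneg_left h4 hk.le
      have h9 : e * D = e ^ (1 - θ) * e ^ θ * D := by rw [← h5]
      linarith
    by_contra! h10
    exact absurd h7 (not_le.2 (mul_pos h6 h10))
  have hlim : Tendsto (fun e : ℝ => e ^ θ * D + k * (A / 2) ^ (1 - θ)) (𝓝[>] 0)
      (𝓝 (k * (A / 2) ^ (1 - θ))) := by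
    have h1 : Tendsto (fun e : ℝ => e ^ θ) (𝓝 0) (𝓝 0) := by
      simpa [Real.zero_rpow hθ.1.ne'] using
        (Real.continuousAt_rpow_const 0 θ (Or.inr hθ.1.le)).tendsto
    simpa using ((h1.mono_left nhdsWithin_le_nhds).mul_const D).add_const (k * (A / 2) ^ (1 - θ))
  have h1 := le_of_tendsto hlim hev
  have h2 : 0 < k * (A / 2) ^ (1 - θ) := mul_pos hk (Real.rpow_pos_of_pos (by linarith) _)
  linarith

/-- Strict tangent line inequality for a concave power. -/
lemma rpow_lt_tangent {θ s φ : ℝ} (hθ : θ ∈ Ioo (0 : ℝ) 1) (hs : 0 < s) (hφ : 0 ≤ φ)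
    (hne : φ ≠ s) : φ ^ (1 - θ) < s ^ (1 - θ) + (1 - θ) * s ^ (-θ) * (φ - s) := by
  -- Strict Bernoulli inequality at the ratio `φ / s`, later rescaled by `s ^ (1 - θ)`.
  have h1 := rpow_one_add_lt_one_add_mul_self (s := φ / s - 1) (p := 1 - θ)
    (by have : 0 ≤ φ / s := by positivity
        linarith)
    (by rw [sub_ne_zero, ne_eq, div_eq_one_iff_eq hs.ne']; exact hne)
    (by linarith [hθ.2]) (by linarith [hθ.1])
  rw [add_sub_cancel, Real.div_rpow hφ hs.le, div_lt_iff₀ (Real.rpow_pos_of_pos hs _)] at h1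
  have h2 : s ^ (1 - θ) = s * s ^ (-θ) := by
    rw [sub_eq_add_neg, Real.rpow_add hs, Real.rpow_one]
  refine h1.trans_eq ?_
  rw [h2]
  field_simp

/-- The unique maximizer on `[0, C]` of a power utility minus a linear cost. -/
lemma utility_lt_of_ne {θ κ q C φ : ℝ} (hθ : θ ∈ Ioo (0 : ℝ) 1) (hκ : 0 < κ) (hq : 0 < q)
    (hC : 0 < C) (hφ : φ ∈ Icc 0 C) (hne : φ ≠ min C ((κ / q) ^ (1 / θ))) :
    κ * (φ ^ (1 - θ) / (1 - θ)) - q * φ <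
      κ * ((min C ((κ / q) ^ (1 / θ))) ^ (1 - θ) / (1 - θ)) -
        q * min C ((κ / q) ^ (1 / θ)) := by
  have h1θ : 0 < 1 - θ := by linarith [hθ.2]
  have hm : 0 < (κ / q) ^ (1 / θ) := Real.rpow_pos_of_pos (by positivity) _
  have hmθ : κ * ((κ / q) ^ (1 / θ)) ^ (-θ) = q := by
    rw [← Real.rpow_mul (by positivity), show 1 / θ * -θ = -1 by field_simp [hθ.1.ne'],
      Real.rpow_neg_one]
    field_simp
  set m := (κ / q) ^ (1 / θ) with hm_def
  set s := min C m with hs_def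
  have hs : 0 < s := lt_min hC hm
  have h1 := rpow_lt_tangent hθ hs hφ.1 hne
  -- First-order optimality on `[0, C]`: the derivative at `s` vanishes if the cap is inactive, and
  -- is nonnegative with `φ ≤ s` if `s = C`.
  have h2 : (κ * s ^ (-θ) - q) * (φ - s) ≤ 0 := by
    rcases le_total m C with h | h
    · rw [hs_def, min_eq_right h, hmθ]; simp
    · rw [hs_def, min_eq_left h]
      refine mul_nonpos_of_nonneg_of_nonpos ?_ (by linarith [hφ.2])
      have : m ^ (-θ) ≤ C ^ (-θ) :=
        Real.rpow_le_rpow_of_nonpos hC h (by linarith [hθ.1])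
      nlinarith
  have h3 : κ * (φ ^ (1 - θ) / (1 - θ)) <
      κ * ((s ^ (1 - θ) + (1 - θ) * s ^ (-θ) * (φ - s)) / (1 - θ)) := by gcongr
  have h4 : κ * ((s ^ (1 - θ) + (1 - θ) * s ^ (-θ) * (φ - s)) / (1 - θ)) =
      κ * (s ^ (1 - θ) / (1 - θ)) + κ * s ^ (-θ) * (φ - s) := by field_simp
  linarith

/-- The clipped vertex maximizes a concave parabola on `[-Z, Z]`. -/
lemma parabola_le_clip {P b Z ψ : ℝ} (hb : 0 < b) (hψ : ψ ∈ Icc (-Z) Z) :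
    P * ψ - b * ψ ^ 2 ≤ P * max (-Z) (min Z (P / (2 * b))) -
      b * (max (-Z) (min Z (P / (2 * b)))) ^ 2 := by
  obtain ⟨u, rfl⟩ : ∃ u, P = 2 * b * u := ⟨P / (2 * b), by field_simp⟩
  have hu : 2 * b * u / (2 * b) = u := by field_simp
  rw [hu]
  set v := max (-Z) (min Z u) with hv
  -- After completing the square, the claim is that `v` is the point of `[-Z, Z]` nearest to the
  -- vertex `u`.
  suffices h : (v - u) ^ 2 ≤ (ψ - u) ^ 2 by nlinarith
  obtain ⟨h1, h2⟩ := hψ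
  rw [sq_le_sq]
  rcases le_total Z u with h | h
  · have : v = Z := by rw [hv, min_eq_left h, max_eq_right (by linarith)]
    rw [this, abs_of_nonpos (by linarith), abs_of_nonpos (by linarith)]
    linarith
  · rcases le_total (-Z) u with h' | h'
    · have : v = u := by rw [hv, min_eq_right h, max_eq_right h']
      rw [this]; simp
    · have : v = -Z := by rw [hv, min_eq_right h, max_eq_left h']
      rw [this, abs_of_nonneg (by linarith), abs_of_nonneg (by linarith)]
      linarith

/-- Quadratic lower bound for the first order expansion of a `C²` function on a compact
interval. -/
lemma exists_taylor_lower_bound {w : ℝ → ℝ} (hw : ContDiff ℝ 2 w) (R : ℝ) :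
    ∃ K, 0 ≤ K ∧ ∀ u ∈ Icc (-R) R, ∀ v ∈ Icc (-R) R,
      w u + deriv w u * (v - u) - K * (v - u) ^ 2 ≤ w v := by
  have hw' : ContDiff ℝ 1 (deriv w) := by
    rw [show (2 : WithTop ℕ∞) = 1 + 1 by norm_num] at hw
    exact (contDiff_succ_iff_deriv.1 hw).2.2
  obtain ⟨L, hL⟩ := hw'.contDiffOn.exists_lipschitzOnWith (s := Icc (-R) R) (by decide)
    (convex_Icc _ _) isCompact_Icc
  refine ⟨L, L.2, fun u hu v hv => ?_⟩
  have hseg : ∀ y ∈ uIcc u v, |y - u| ≤ |v - u| := fun y hy => abs_sub_left_of_mem_uIcc hy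
  -- Mean value inequality for `w` minus its linear part at `u`; the derivative is bounded by the
  -- Lipschitz constant of `deriv w` times `|v - u|`.
  have key := (convex_uIcc u v).norm_image_sub_le_of_norm_hasDerivWithin_le
    (f := fun y => w y - deriv w u * y) (f' := fun y => deriv w y - deriv w u)
    (C := L * |v - u|) (x := u) (y := v)
    (fun y hy => ?_) (fun y hy => ?_) left_mem_uIcc right_mem_uIcc
  · have h1 := (abs_le.1 key).1
    rw [Real.norm_eq_abs, mul_assoc, ← sq, sq_abs] at h1
    linarith
  · have h1 : HasDerivAt w (deriv w y) y :=
      ((hw.differentiable (by norm_num)) y).hasDerivAt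
    have h2 := h1.sub ((hasDerivAt_id y).const_mul (deriv w u))
    rw [mul_one] at h2
    exact h2.hasDerivWithinAt
  · have hyR : y ∈ Icc (-R) R := (ordConnected_Icc.uIcc_subset hu hv) hy
    have h1 := hL.dist_le_mul y hyR u hu
    rw [Real.dist_eq, Real.dist_eq] at h1
    exact h1.trans (mul_le_mul_of_nonneg_left (hseg y hy) L.2)

/-! ### Absolutely continuous functions and primitives. -/

/-- An absolutely continuous function is recovered from its almost everywhere derivative. -/
lemma AbsolutelyContinuousOnInterval.eq_add_integral {f g : ℝ → ℝ} {T : ℝ}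
    (hf : AbsolutelyContinuousOnInterval f 0 T)
    (hg : ∀ᵐ t ∂(volume.restrict (Icc 0 T)), HasDerivAt f (g t) t) {t : ℝ} (ht : t ∈ Icc 0 T) :
    f t = f 0 + ∫ s in (0 : ℝ)..t, g s := by
  have h0T : (0 : ℝ) ≤ T := ht.1.trans ht.2
  have h1 : AbsolutelyContinuousOnInterval f 0 t := by
    refine hf.mono ?_
    rw [uIcc_of_le ht.1, uIcc_of_le h0T]
    exact Icc_subset_Icc_right ht.2
  have h2 := h1.integral_deriv_eq_sub
  have h3 : ∫ s in (0 : ℝ)..t, deriv f s = ∫ s in (0 : ℝ)..t, g s := by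
    refine intervalIntegral.integral_congr_ae ?_
    rw [ae_restrict_iff' measurableSet_Icc] at hg
    filter_upwards [hg] with s hs hst
    rw [uIoc_of_le ht.1] at hst
    exact (hs ⟨hst.1.le, hst.2.trans ht.2⟩).deriv
  linarith

lemma AbsolutelyContinuousOnInterval.of_contDiff {f : ℝ → ℝ} (hf : ContDiff ℝ 1 f) (a b : ℝ) :
    AbsolutelyContinuousOnInterval f a b :=
  hf.contDiffOn.absolutelyContinuousOnInterval

/-- Primitives of integrable functions are absolutely continuous. -/
lemma absolutelyContinuousOnInterval_const_add_integral {f : ℝ → ℝ} {a b : ℝ}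
    (hf : IntervalIntegrable f volume a b) (k : ℝ) :
    AbsolutelyContinuousOnInterval (fun t => k + ∫ s in a..t, f s) a b :=
  (AbsolutelyContinuousOnInterval.of_contDiff contDiff_const a b).fun_add
    (hf.absolutelyContinuousOnInterval_intervalIntegral left_mem_uIcc)

lemma ae_hasDerivAt_const_add_integral {f : ℝ → ℝ} {T : ℝ} (hT : 0 ≤ T)
    (hf : IntervalIntegrable f volume 0 T) (k : ℝ) :
    ∀ᵐ t ∂(volume.restrict (Icc 0 T)), HasDerivAt (fun t => k + ∫ s in (0 : ℝ)..t, f s) (f t) t := by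
  rw [ae_restrict_iff' measurableSet_Icc]
  filter_upwards [hf.ae_hasDerivAt_integral] with t ht htT
  rw [uIcc_of_le hT] at ht
  exact (ht htT 0 (left_mem_Icc.2 hT)).const_add k

/-- A bounded almost everywhere measurable function on `[0, T]` is integrable there. -/
lemma intervalIntegrable_of_bounded {f : ℝ → ℝ} {T B : ℝ} (hT : 0 ≤ T)
    (hf : AEMeasurable f (volume.restrict (Icc 0 T))) (hB : ∀ t ∈ Icc 0 T, |f t| ≤ B) :
    IntervalIntegrable f volume 0 T := by
  rw [intervalIntegrable_iff_integrableOn_Icc_of_le hT]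
  refine IntegrableOn.of_bound (C := B) (by simp) hf.aestronglyMeasurable ?_
  rw [ae_restrict_iff' measurableSet_Icc]
  exact Filter.Eventually.of_forall hB

/-! ### Reduction to controls: explicit trajectories and value. -/

namespace RelocationModel

variable {M : RelocationModel} {c z a x c' z' : ℝ → ℝ}

/-- Pairs of measurable controls obeying the pointwise bounds. -/
structure IsControl (M : RelocationModel) (c z : ℝ → ℝ) : Prop where
  c_meas : AEMeasurable c (volume.restrict (Icc 0 M.T))
  z_meas : AEMeasurable z (volume.restrict (Icc 0 M.T))
  c_mem : ∀ t ∈ Icc 0 M.T, c t ∈ Icc 0 M.C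
  z_mem : ∀ t ∈ Icc 0 M.T, |z t| ≤ M.Z

/-- The location reached at time `t` under the control `z`. -/
noncomputable def traj (M : RelocationModel) (z : ℝ → ℝ) (t : ℝ) : ℝ :=
  M.x₀ + ∫ s in (0 : ℝ)..t, z s

/-- Discounted net income. -/
noncomputable def flow (M : RelocationModel) (c z : ℝ → ℝ) (s : ℝ) : ℝ :=
  Real.exp (-M.r * s) * (M.w (M.traj z s) - M.p * c s - M.ξ * z s ^ 2)

/-- The assets at time `t` under the controls `(c, z)`. -/
noncomputable def wealth (M : RelocationModel) (c z : ℝ → ℝ) (t : ℝ) : ℝ :=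
  Real.exp (M.r * t) * (M.a₀ + ∫ s in (0 : ℝ)..t, M.flow c z s)

/-- The running payoff at time `t`. -/
noncomputable def payoff (M : RelocationModel) (c z : ℝ → ℝ) (t : ℝ) : ℝ :=
  Real.exp (-M.ρ * t) * (c t ^ (1 - M.θ) / (1 - M.θ) - M.η * z t ^ 2)

lemma Standing.T_nonneg (hM : M.Standing) : 0 ≤ M.T := hM.T_pos.le

namespace IsControl

lemma integrable_c (h : M.IsControl c z) (hT : 0 ≤ M.T) : IntervalIntegrable c volume 0 M.T :=
  intervalIntegrable_of_bounded hT h.c_meas (B := M.C) fun t ht => by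
    rw [abs_of_nonneg (h.c_mem t ht).1]; exact (h.c_mem t ht).2

lemma integrable_z (h : M.IsControl c z) (hT : 0 ≤ M.T) : IntervalIntegrable z volume 0 M.T :=
  intervalIntegrable_of_bounded hT h.z_meas h.z_mem

lemma integrable_z_sq (h : M.IsControl c z) (hT : 0 ≤ M.T) :
    IntervalIntegrable (fun t => z t ^ 2) volume 0 M.T :=
  intervalIntegrable_of_bounded hT (h.z_meas.pow_const 2) (B := M.Z ^ 2) fun t ht => by
    rw [abs_pow]; exact pow_le_pow_left₀ (abs_nonneg _) (h.z_mem t ht) 2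

lemma integrable_utility (h : M.IsControl c z) (hM : M.Standing) :
    IntervalIntegrable (fun t => c t ^ (1 - M.θ)) volume 0 M.T :=
  intervalIntegrable_of_bounded hM.T_nonneg (h.c_meas.pow_const _) (B := M.C ^ (1 - M.θ))
    fun t ht => by
      rw [abs_of_nonneg (Real.rpow_nonneg (h.c_mem t ht).1 _)]
      exact Real.rpow_le_rpow (h.c_mem t ht).1 (h.c_mem t ht).2 (by linarith [hM.θ_mem.2])

lemma traj_ac (h : M.IsControl c z) (hT : 0 ≤ M.T) :
    AbsolutelyContinuousOnInterval (M.traj z) 0 M.T :=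
  absolutelyContinuousOnInterval_const_add_integral (h.integrable_z hT) M.x₀

lemma traj_continuousOn (h : M.IsControl c z) (hT : 0 ≤ M.T) :
    ContinuousOn (M.traj z) (uIcc 0 M.T) :=
  (h.traj_ac hT).continuousOn

lemma integrable_flow (h : M.IsControl c z) (hM : M.Standing) :
    IntervalIntegrable (M.flow c z) volume 0 M.T := by
  have hT := hM.T_nonneg
  have h1 : IntervalIntegrable (fun t => M.w (M.traj z t)) volume 0 M.T :=
    (hM.w_smooth.continuous.comp_continuousOn (h.traj_continuousOn hT)).intervalIntegrable
  have h2 := (h1.sub ((h.integrable_c hT).const_mul M.p)).sub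
    ((h.integrable_z_sq hT).const_mul M.ξ)
  exact h2.continuousOn_mul
    (by fun_prop : ContinuousOn (fun t => Real.exp (-M.r * t)) (uIcc 0 M.T))

lemma integrable_payoff (h : M.IsControl c z) (hM : M.Standing) :
    IntervalIntegrable (M.payoff c z) volume 0 M.T := by
  have h2 := ((h.integrable_utility hM).div_const (1 - M.θ)).sub
    ((h.integrable_z_sq hM.T_nonneg).const_mul M.η)
  exact h2.continuousOn_mul
    (by fun_prop : ContinuousOn (fun t => Real.exp (-M.ρ * t)) (uIcc 0 M.T))

lemma wealth_ac (h : M.IsControl c z) (hM : M.Standing) :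
    AbsolutelyContinuousOnInterval (M.wealth c z) 0 M.T :=
  (AbsolutelyContinuousOnInterval.of_contDiff
    (by fun_prop : ContDiff ℝ 1 fun t => Real.exp (M.r * t)) 0 M.T).fun_mul
    (absolutelyContinuousOnInterval_const_add_integral (h.integrable_flow hM) M.a₀)

/-- Controls with nonnegative final wealth are admissible. -/
lemma isAdmissible (h : M.IsControl c z) (hM : M.Standing) (hW : 0 ≤ M.wealth c z M.T) :
    M.IsAdmissible c z (M.wealth c z) (M.traj z) where
  c_meas := h.c_meas
  z_meas := h.z_meas
  c_mem := h.c_mem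
  z_mem := h.z_mem
  a_ac := h.wealth_ac hM
  x_ac := h.traj_ac hM.T_nonneg
  a_init := by simp [wealth]
  x_init := by simp [traj]
  a_ode := by
    filter_upwards [ae_hasDerivAt_const_add_integral hM.T_nonneg (h.integrable_flow hM) M.a₀]
      with t ht
    have h1 : HasDerivAt (fun t => Real.exp (M.r * t)) (Real.exp (M.r * t) * M.r) t := by
      simpa using ((hasDerivAt_id t).const_mul M.r).exp
    have h2 := h1.mul ht
    refine h2.congr_deriv ?_
    have h3 : Real.exp (M.r * t) * M.flow c z t =
        M.w (M.traj z t) - M.p * c t - M.ξ * z t ^ 2 := by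
      rw [flow, ← mul_assoc, ← Real.exp_add]
      simp
    rw [h3, wealth]
    ring
  x_ode := ae_hasDerivAt_const_add_integral hM.T_nonneg (h.integrable_z hM.T_nonneg) M.x₀
  a_final := hW

end IsControl

namespace IsAdmissible

lemma isControl (h : M.IsAdmissible c z a x) : M.IsControl c z :=
  ⟨h.c_meas, h.z_meas, h.c_mem, h.z_mem⟩

lemma eq_traj (h : M.IsAdmissible c z a x) {t : ℝ} (ht : t ∈ Icc 0 M.T) : x t = M.traj z t := by
  rw [h.x_ac.eq_add_integral h.x_ode ht, h.x_init, traj]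

lemma eq_wealth (h : M.IsAdmissible c z a x) {t : ℝ} (ht : t ∈ Icc 0 M.T) :
    a t = M.wealth c z t := by
  -- Integrating factor: the derivative of `exp (-r s) * a s` no longer contains `a`.
  have h1 : AbsolutelyContinuousOnInterval (fun s => Real.exp (-M.r * s) * a s) 0 M.T :=
    (AbsolutelyContinuousOnInterval.of_contDiff
      (by fun_prop : ContDiff ℝ 1 fun t => Real.exp (-M.r * t)) 0 M.T).fun_mul h.a_ac
  have h2 : ∀ᵐ s ∂(volume.restrict (Icc 0 M.T)),
      HasDerivAt (fun s => Real.exp (-M.r * s) * a s) (M.flow c z s) s := by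
    filter_upwards [h.a_ode, ae_restrict_mem measurableSet_Icc] with s hs hsT
    have h1 : HasDerivAt (fun t => Real.exp (-M.r * t)) (Real.exp (-M.r * s) * -M.r) s := by
      simpa using ((hasDerivAt_id s).const_mul (-M.r)).exp
    refine (h1.mul hs).congr_deriv ?_
    rw [flow, ← h.eq_traj hsT]
    ring
  have h3 := h1.eq_add_integral h2 ht
  simp only [mul_zero, Real.exp_zero, one_mul, h.a_init] at h3
  rw [wealth, ← h3, ← mul_assoc, ← Real.exp_add]
  simp

end IsAdmissible

/-- The value of a pair of controls. -/
noncomputable def value (M : RelocationModel) (c z : ℝ → ℝ) : ℝ :=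
  (∫ t in (0 : ℝ)..M.T, M.payoff c z t) +
    Real.exp (-M.ρ * M.T) / (1 - M.θ) * M.wealth c z M.T ^ (1 - M.θ)

/-- Optimality expressed in terms of controls alone. -/
structure IsOptimalControl (M : RelocationModel) (c z : ℝ → ℝ) : Prop where
  isControl : M.IsControl c z
  wealth_nonneg : 0 ≤ M.wealth c z M.T
  value_le : ∀ c' z', M.IsControl c' z' → 0 ≤ M.wealth c' z' M.T → M.value c' z' ≤ M.value c z

lemma J_eq_value (haT : a M.T = M.wealth c z M.T) : M.J c z a = M.value c z := by
  rw [J, value, haT]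
  simp only [payoff]
  ring

lemma IsOptimal.isOptimalControl (hM : M.Standing) (h : M.IsOptimal c z a x) :
    M.IsOptimalControl c z where
  isControl := h.1.isControl
  wealth_nonneg := by
    rw [← h.1.eq_wealth (right_mem_Icc.2 hM.T_nonneg)]
    exact h.1.a_final
  value_le c' z' hc' hW := by
    have h1 := h.2 c' z' _ _ (hc'.isAdmissible hM hW)
    rwa [J_eq_value rfl, J_eq_value (h.1.eq_wealth (right_mem_Icc.2 hM.T_nonneg))] at h1

end RelocationModel

/-! ### Convex variations of the optimal controls. -/

namespace RelocationModel

variable {M : RelocationModel} {c z a x c' z' : ℝ → ℝ}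

/-- The point at parameter `e` of the segment from `f` to `g`. -/
def blend (f g : ℝ → ℝ) (e t : ℝ) : ℝ := f t + e * (g t - f t)

/-- The first variation of the discounted net income in the direction of `(c', z')`. -/
noncomputable def flowVar (M : RelocationModel) (c z c' z' : ℝ → ℝ) (s : ℝ) : ℝ :=
  Real.exp (-M.r * s) * (deriv M.w (M.traj z s) * (M.traj z' s - M.traj z s) -
    M.p * (c' s - c s) - M.ξ * (z' s ^ 2 - z s ^ 2))

/-- The first variation of the final wealth in the direction of `(c', z')`. -/
noncomputable def wealthVar (M : RelocationModel) (c z c' z' : ℝ → ℝ) : ℝ :=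
  Real.exp (M.r * M.T) * ∫ s in (0 : ℝ)..M.T, M.flowVar c z c' z' s

lemma IsControl.blend (h : M.IsControl c z) (h' : M.IsControl c' z') {e : ℝ}
    (he : e ∈ Icc (0 : ℝ) 1) : M.IsControl (blend c c' e) (blend z z' e) where
  c_meas := h.c_meas.add ((h'.c_meas.sub h.c_meas).const_mul e)
  z_meas := h.z_meas.add ((h'.z_meas.sub h.z_meas).const_mul e)
  c_mem t ht := (convex_Icc 0 M.C).add_smul_sub_mem (h.c_mem t ht) (h'.c_mem t ht) he
  z_mem t ht := abs_le.2 ((convex_Icc (-M.Z) M.Z).add_smul_sub_mem (abs_le.1 (h.z_mem t ht))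
    (abs_le.1 (h'.z_mem t ht)) he)

lemma IsControl.traj_blend (h : M.IsControl c z) (h' : M.IsControl c' z') (e : ℝ) {t : ℝ}
    (ht : t ∈ Icc 0 M.T) : M.traj (RelocationModel.blend z z' e) t =
      M.traj z t + e * (M.traj z' t - M.traj z t) := by
  have hT : 0 ≤ M.T := ht.1.trans ht.2
  have hsub : uIcc 0 t ⊆ uIcc 0 M.T := by
    rw [uIcc_of_le ht.1, uIcc_of_le hT]; exact Icc_subset_Icc_right ht.2
  have h1 := (h.integrable_z hT).mono_set hsub
  have h2 := (h'.integrable_z hT).mono_set hsub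
  simp only [traj, RelocationModel.blend]
  rw [intervalIntegral.integral_add h1 ((h2.sub h1).const_mul e),
    intervalIntegral.integral_const_mul, intervalIntegral.integral_sub h2 h1]
  ring

lemma Standing.continuous_deriv_w (hM : M.Standing) : Continuous (deriv M.w) :=
  hM.w_smooth.continuous_deriv (by norm_num)

lemma IsControl.integrable_flowVar (h : M.IsControl c z) (h' : M.IsControl c' z')
    (hM : M.Standing) : IntervalIntegrable (M.flowVar c z c' z') volume 0 M.T := by
  have hT := hM.T_nonneg
  have h1 : IntervalIntegrable
      (fun s => deriv M.w (M.traj z s) * (M.traj z' s - M.traj z s)) volume 0 M.T :=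
    ((hM.continuous_deriv_w.comp_continuousOn (h.traj_continuousOn hT)).mul
      ((h'.traj_continuousOn hT).sub (h.traj_continuousOn hT))).intervalIntegrable
  have h2 := (h1.sub (((h'.integrable_c hT).sub (h.integrable_c hT)).const_mul M.p)).sub
    (((h'.integrable_z_sq hT).sub (h.integrable_z_sq hT)).const_mul M.ξ)
  exact h2.continuousOn_mul
    (by fun_prop : ContinuousOn (fun t => Real.exp (-M.r * t)) (uIcc 0 M.T))

/-- The difference of the two sides is `e * (1 - e) * (v - u) ^ 2`. -/
lemma sq_blend_le (u v : ℝ) {e : ℝ} (he : e ∈ Icc (0 : ℝ) 1) :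
    (u + e * (v - u)) ^ 2 ≤ u ^ 2 + e * (v ^ 2 - u ^ 2) := by
  nlinarith [mul_nonneg (mul_nonneg he.1 (sub_nonneg.2 he.2)) (sq_nonneg (v - u))]

/-- Consumption enters linearly, the relocation cost is convex, and only the wage needs a
second-order remainder. That remainder is uniform because both trajectories stay in a compact
interval. -/
lemma IsControl.exists_flow_blend_ge (h : M.IsControl c z) (h' : M.IsControl c' z')
    (hM : M.Standing) : ∃ K, ∀ e ∈ Icc (0 : ℝ) 1, ∀ s ∈ Icc 0 M.T,
      M.flow c z s + e * M.flowVar c z c' z' s - K * e ^ 2 ≤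
        M.flow (RelocationModel.blend c c' e) (RelocationModel.blend z z' e) s := by
  have hT := hM.T_nonneg
  obtain ⟨R₁, hR₁⟩ := isCompact_Icc.exists_bound_of_continuousOn (h.traj_continuousOn hT)
  obtain ⟨R₂, hR₂⟩ := isCompact_Icc.exists_bound_of_continuousOn (h'.traj_continuousOn hT)
  obtain ⟨K, hK0, hK⟩ := exists_taylor_lower_bound hM.w_smooth (max R₁ R₂)
  refine ⟨K * (R₁ + R₂) ^ 2, fun e he s hs => ?_⟩
  have hs' : s ∈ uIcc 0 M.T := by rwa [uIcc_of_le hT]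
  have hx₁ := hR₁ s hs'
  have hx₂ := hR₂ s hs'
  rw [Real.norm_eq_abs] at hx₁ hx₂
  set u := M.traj z s with hu
  set v := M.traj z' s with hv
  have hub : u ∈ Icc (-max R₁ R₂) (max R₁ R₂) := abs_le.1 (hx₁.trans (le_max_left _ _))
  have hvb : v ∈ Icc (-max R₁ R₂) (max R₁ R₂) := abs_le.1 (hx₂.trans (le_max_right _ _))
  have hmb : u + e * (v - u) ∈ Icc (-max R₁ R₂) (max R₁ R₂) :=
    (convex_Icc _ _).add_smul_sub_mem hub hvb he
  have h1 := hK u hub _ hmb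
  rw [add_sub_cancel_left] at h1
  have h2 : (e * (v - u)) ^ 2 ≤ e ^ 2 * (R₁ + R₂) ^ 2 := by
    rw [mul_pow]
    refine mul_le_mul_of_nonneg_left ?_ (sq_nonneg e)
    refine sq_le_sq' ?_ ?_ <;> linarith [(abs_le.1 hx₁).1, (abs_le.1 hx₁).2, (abs_le.1 hx₂).1,
      (abs_le.1 hx₂).2]
  have h3 := mul_le_mul_of_nonneg_left h2 hK0
  have h4 := mul_le_mul_of_nonneg_left (sq_blend_le (z s) (z' s) he) hM.ξ_pos.le
  have hE0 := Real.exp_pos (-M.r * s)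
  have hE1 : Real.exp (-M.r * s) ≤ 1 := by
    rw [Real.exp_le_one_iff]; nlinarith [hM.r_pos, hs.1]
  have h5 : Real.exp (-M.r * s) * (K * (R₁ + R₂) ^ 2 * e ^ 2) ≤ K * (R₁ + R₂) ^ 2 * e ^ 2 :=
    mul_le_of_le_one_left (by positivity) hE1
  rw [flow, flow, flowVar, h.traj_blend h' e hs, ← hu, ← hv]
  simp only [RelocationModel.blend]
  have h6 : M.w u - M.p * c s - M.ξ * z s ^ 2 + e * (deriv M.w u * (v - u) -
      M.p * (c' s - c s) - M.ξ * (z' s ^ 2 - z s ^ 2)) - K * (R₁ + R₂) ^ 2 * e ^ 2 ≤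
      M.w (u + e * (v - u)) - M.p * (c s + e * (c' s - c s)) -
        M.ξ * (z s + e * (z' s - z s)) ^ 2 := by linarith
  have h7 := mul_le_mul_of_nonneg_left h6 hE0.le
  linarith

lemma IsControl.exists_wealth_blend_ge (h : M.IsControl c z) (h' : M.IsControl c' z')
    (hM : M.Standing) : ∃ K, ∀ e ∈ Icc (0 : ℝ) 1,
      M.wealth c z M.T + e * M.wealthVar c z c' z' - K * e ^ 2 ≤
        M.wealth (RelocationModel.blend c c' e) (RelocationModel.blend z z' e) M.T := by
  obtain ⟨K, hK⟩ := h.exists_flow_blend_ge h' hM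
  refine ⟨Real.exp (M.r * M.T) * (K * M.T), fun e he => ?_⟩
  have i1 := h.integrable_flow hM
  have i2 := (h.integrable_flowVar h' hM).const_mul e
  have h1 : ∫ s in (0 : ℝ)..M.T, (M.flow c z s + e * M.flowVar c z c' z' s - K * e ^ 2) ≤
      ∫ s in (0 : ℝ)..M.T,
        M.flow (RelocationModel.blend c c' e) (RelocationModel.blend z z' e) s :=
    intervalIntegral.integral_mono_on hM.T_nonneg ((i1.add i2).sub intervalIntegrable_const)
      ((h.blend h' he).integrable_flow hM) (hK e he)
  rw [intervalIntegral.integral_sub (i1.add i2) intervalIntegrable_const,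
    intervalIntegral.integral_add i1 i2, intervalIntegral.integral_const_mul,
    intervalIntegral.integral_const, smul_eq_mul, sub_zero] at h1
  have h2 := mul_le_mul_of_nonneg_left h1 (Real.exp_pos (M.r * M.T)).le
  rw [wealth, wealth, wealthVar]
  linarith

/-- Concavity yields the full payoff difference, avoiding the derivative of `c ^ (1 - θ)`, which is
singular at zero consumption. -/
lemma IsControl.payoff_blend_ge (h : M.IsControl c z) (h' : M.IsControl c' z')
    (hM : M.Standing) {e t : ℝ} (he : e ∈ Icc (0 : ℝ) 1) (ht : t ∈ Icc 0 M.T) :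
    M.payoff c z t + e * (M.payoff c' z' t - M.payoff c z t) ≤
      M.payoff (RelocationModel.blend c c' e) (RelocationModel.blend z z' e) t := by
  have hθ : 0 < 1 - M.θ := by linarith [hM.θ_mem.2]
  have h1 := (Real.concaveOn_rpow hθ.le (by linarith [hM.θ_mem.1] : 1 - M.θ ≤ 1)).2
    (h.c_mem t ht).1 (h'.c_mem t ht).1 (sub_nonneg.2 he.2) he.1 (by ring)
  simp only [smul_eq_mul] at h1
  rw [show (1 - e) * c t + e * c' t = c t + e * (c' t - c t) by ring] at h1
  have h2 := div_le_div_of_nonneg_right h1 hθ.le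
  have h3 := mul_le_mul_of_nonneg_left (sq_blend_le (z t) (z' t) he) hM.η_pos.le
  have h4 : (c t ^ (1 - M.θ) / (1 - M.θ) - M.η * z t ^ 2) +
      e * ((c' t ^ (1 - M.θ) / (1 - M.θ) - M.η * z' t ^ 2) -
        (c t ^ (1 - M.θ) / (1 - M.θ) - M.η * z t ^ 2)) ≤
      (c t + e * (c' t - c t)) ^ (1 - M.θ) / (1 - M.θ) -
        M.η * (z t + e * (z' t - z t)) ^ 2 := by
    rw [add_div, mul_div_assoc, mul_div_assoc] at h2
    linarith
  have h5 := mul_le_mul_of_nonneg_left h4 (Real.exp_pos (-M.ρ * t)).le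
  simp only [payoff, RelocationModel.blend]
  linarith

lemma IsControl.integral_payoff_blend_ge (h : M.IsControl c z) (h' : M.IsControl c' z')
    (hM : M.Standing) {e : ℝ} (he : e ∈ Icc (0 : ℝ) 1) :
    (∫ t in (0 : ℝ)..M.T, M.payoff c z t) +
      e * ∫ t in (0 : ℝ)..M.T, (M.payoff c' z' t - M.payoff c z t) ≤
      ∫ t in (0 : ℝ)..M.T,
        M.payoff (RelocationModel.blend c c' e) (RelocationModel.blend z z' e) t := by
  have i1 := h.integrable_payoff hM
  have i2 := ((h'.integrable_payoff hM).sub i1).const_mul e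
  rw [← intervalIntegral.integral_const_mul, ← intervalIntegral.integral_add i1 i2]
  exact intervalIntegral.integral_mono_on hM.T_nonneg (i1.add i2)
    ((h.blend h' he).integrable_payoff hM) fun t ht => h.payoff_blend_ge h' hM he ht

/-- The hypothesis on the quadratic expression makes the blended controls feasible. Monotonicity of
terminal utility then lets that expression replace the true final wealth. -/
lemma IsOptimalControl.exists_variation (h : M.IsOptimalControl c z) (h' : M.IsControl c' z')
    (hM : M.Standing) : ∃ K, ∀ e ∈ Icc (0 : ℝ) 1,
      0 ≤ M.wealth c z M.T + e * M.wealthVar c z c' z' - K * e ^ 2 →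
      e * (∫ t in (0 : ℝ)..M.T, (M.payoff c' z' t - M.payoff c z t)) +
        Real.exp (-M.ρ * M.T) / (1 - M.θ) *
          (M.wealth c z M.T + e * M.wealthVar c z c' z' - K * e ^ 2) ^ (1 - M.θ) ≤
      Real.exp (-M.ρ * M.T) / (1 - M.θ) * M.wealth c z M.T ^ (1 - M.θ) := by
  have hθ : 0 < 1 - M.θ := by linarith [hM.θ_mem.2]
  obtain ⟨K, hK⟩ := h.isControl.exists_wealth_blend_ge h' hM
  refine ⟨K, fun e he h0 => ?_⟩
  have h1 := h.value_le _ _ (h.isControl.blend h' he) (h0.trans (hK e he))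
  have h2 := h.isControl.integral_payoff_blend_ge h' hM he
  have h3 := mul_le_mul_of_nonneg_left (Real.rpow_le_rpow h0 (hK e he) hθ.le)
    (by positivity : 0 ≤ Real.exp (-M.ρ * M.T) / (1 - M.θ))
  rw [value, value] at h1
  linarith

/-- Infinite marginal utility at zero wealth would outweigh any first-order loss of payoff. -/
lemma IsOptimalControl.wealthVar_nonpos (h : M.IsOptimalControl c z) (h' : M.IsControl c' z')
    (hM : M.Standing) (hW : M.wealth c z M.T = 0) : M.wealthVar c z c' z' ≤ 0 := by
  have hθ : 0 < 1 - M.θ := by linarith [hM.θ_mem.2]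
  obtain ⟨K, hK⟩ := h.exists_variation h' hM
  rw [hW] at hK
  simp only [zero_add, Real.zero_rpow hθ.ne', mul_zero] at hK
  exact first_order_of_zero hM.θ_mem (by positivity) hK

lemma IsOptimalControl.variation_nonpos (h : M.IsOptimalControl c z) (h' : M.IsControl c' z')
    (hM : M.Standing) (hW : 0 < M.wealth c z M.T) :
    (∫ t in (0 : ℝ)..M.T, (M.payoff c' z' t - M.payoff c z t)) +
      Real.exp (-M.ρ * M.T) * M.wealth c z M.T ^ (-M.θ) * M.wealthVar c z c' z' ≤ 0 := by
  have hθ : 0 < 1 - M.θ := by linarith [hM.θ_mem.2]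
  obtain ⟨K, hK⟩ := h.exists_variation h' hM
  have h1 := first_order_of_pos hW hK
  convert! h1 using 2
  field_simp

end RelocationModel

/-! ### Positivity of optimal final wealth. -/

namespace RelocationModel

variable {M : RelocationModel} {c z a x c' z' : ℝ → ℝ}

namespace Standing

lemma annuity_pos (hM : M.Standing) : 0 < (1 - Real.exp (-M.r * M.T)) / M.r := by
  refine div_pos (sub_pos.2 (Real.exp_lt_one_iff.2 ?_)) hM.r_pos
  nlinarith [mul_pos hM.r_pos hM.T_pos]

lemma C_pos (hM : M.Standing) : 0 < M.C := by
  refine lt_of_le_of_lt ?_ hM.C_large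
  have h1 : 0 ≤ ⨆ x, |M.w x| := Real.iSup_nonneg fun x => abs_nonneg _
  have h2 := hM.annuity_pos
  have h3 := hM.T_pos
  have h4 := hM.p_pos
  have h5 := hM.a₀_nonneg
  positivity

lemma Z_pos (hM : M.Standing) : 0 < M.Z := by
  refine lt_of_le_of_lt ?_ hM.Z_large
  have h1 : 0 ≤ ⨆ x, |deriv M.w x| := Real.iSup_nonneg fun x => abs_nonneg _
  have h3 := hM.T_pos
  have h4 := hM.ξ_pos
  positivity

lemma w_nonneg (hM : M.Standing) {y : ℝ} (hy : y ∈ Icc (0 : ℝ) 1) : 0 ≤ M.w y := by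
  have h : closure (Ioo (0 : ℝ) 1) ⊆ {x | 0 ≤ M.w x} :=
    closure_minimal (fun u hu => (hM.w_pos u hu).le)
      (isClosed_le continuous_const hM.w_smooth.continuous)
  rw [closure_Ioo (by norm_num)] at h
  exact h hy

/-- In `[0, 1]` the wage can vanish only at the endpoints, where the sign of its derivative is
prescribed. -/
lemma deriv_w_ne_zero (hM : M.Standing) {y : ℝ} (hy : y ∈ Icc (0 : ℝ) 1) (hw : M.w y = 0) :
    deriv M.w y ≠ 0 := by
  rcases hy.1.eq_or_lt with h0 | h0
  · exact (hM.w'_pos y h0.symm.le).ne'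
  · rcases hy.2.eq_or_lt with h1 | h1
    · exact (hM.w'_neg y h1.symm.le).ne
    · exact absurd hw (hM.w_pos y ⟨h0, h1⟩).ne'

lemma isControl_const (_hM : M.Standing) {φ ψ : ℝ} (hφ : φ ∈ Icc 0 M.C) (hψ : |ψ| ≤ M.Z) :
    M.IsControl (fun _ => φ) (fun _ => ψ) :=
  ⟨aemeasurable_const, aemeasurable_const, fun _ _ => hφ, fun _ _ => hψ⟩

end Standing

lemma traj_zero (t : ℝ) : M.traj (fun _ => 0) t = M.x₀ := by simp [traj]

lemma integral_discount_pos (hM : M.Standing) :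
    0 < ∫ s in (0 : ℝ)..M.T, Real.exp (-M.r * s) :=
  intervalIntegral.intervalIntegral_pos_of_pos
    ((by fun_prop : Continuous fun s => Real.exp (-M.r * s)).intervalIntegrable _ _)
    (fun s => Real.exp_pos _) hM.T_pos

lemma wealth_zero : M.wealth (fun _ => 0) (fun _ => 0) M.T =
    Real.exp (M.r * M.T) *
      (M.a₀ + (∫ s in (0 : ℝ)..M.T, Real.exp (-M.r * s)) * M.w M.x₀) := by
  rw [wealth, ← intervalIntegral.integral_mul_const]
  simp [flow, traj_zero]

lemma value_zero (hM : M.Standing) : M.value (fun _ => 0) (fun _ => 0) =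
    Real.exp (-M.ρ * M.T) / (1 - M.θ) *
      M.wealth (fun _ => 0) (fun _ => 0) M.T ^ (1 - M.θ) := by
  have hθ : 1 - M.θ ≠ 0 := by linarith [hM.θ_mem.2]
  simp [value, payoff, Real.zero_rpow hθ]

lemma wealthVar_zero_const (ζ : ℝ) :
    M.wealthVar (fun _ => 0) (fun _ => 0) (fun _ => 0) (fun _ => ζ) =
      Real.exp (M.r * M.T) * (deriv M.w M.x₀ * ζ *
        (∫ s in (0 : ℝ)..M.T, Real.exp (-M.r * s) * s) -
        M.ξ * ζ ^ 2 * ∫ s in (0 : ℝ)..M.T, Real.exp (-M.r * s)) := by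
  rw [wealthVar, ← intervalIntegral.integral_const_mul (deriv M.w M.x₀ * ζ),
    ← intervalIntegral.integral_const_mul (M.ξ * ζ ^ 2), ← intervalIntegral.integral_sub]
  · congr 1
    refine intervalIntegral.integral_congr fun s _ => ?_
    simp only [flowVar, traj, intervalIntegral.integral_const, smul_eq_mul, sub_zero, mul_zero]
    rw [add_zero]
    ring
  · exact (by fun_prop : Continuous fun s =>
      deriv M.w M.x₀ * ζ * (Real.exp (-M.r * s) * s)).intervalIntegrable _ _
  · exact (by fun_prop : Continuous fun s =>
      M.ξ * ζ ^ 2 * Real.exp (-M.r * s)).intervalIntegrable _ _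

/-- Doing nothing is not optimal if it leaves no final wealth. -/
lemma not_isOptimalControl_zero (hM : M.Standing)
    (hW : M.wealth (fun _ => 0) (fun _ => 0) M.T = 0) :
    ¬ M.IsOptimalControl (fun _ => 0) (fun _ => 0) := by
  intro h
  have hβ := integral_discount_pos hM
  have hα : 0 < ∫ s in (0 : ℝ)..M.T, Real.exp (-M.r * s) * s :=
    intervalIntegral.intervalIntegral_pos_of_pos_on
      ((by fun_prop : Continuous fun s => Real.exp (-M.r * s) * s).intervalIntegrable _ _)
      (fun s hs => mul_pos (Real.exp_pos _) hs.1) hM.T_pos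
  have hw0 : M.w M.x₀ = 0 := by
    rw [wealth_zero] at hW
    have h1 := (mul_eq_zero.1 hW).resolve_left (Real.exp_pos _).ne'
    have h2 := mul_nonneg hβ.le (hM.w_nonneg hM.x₀_mem)
    have h3 := hM.a₀_nonneg
    exact (mul_eq_zero.1 (by linarith : (∫ s in (0 : ℝ)..M.T, Real.exp (-M.r * s)) * M.w M.x₀ =
      0)).resolve_left hβ.ne'
  have hd := hM.deriv_w_ne_zero hM.x₀_mem hw0
  set d := deriv M.w M.x₀ with hd_def
  set α := ∫ s in (0 : ℝ)..M.T, Real.exp (-M.r * s) * s with hα_def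
  set β := ∫ s in (0 : ℝ)..M.T, Real.exp (-M.r * s) with hβ_def
  have hξ := hM.ξ_pos
  have hdabs := abs_pos.2 hd
  -- The test speed `δ * d` points toward higher wages. The first bound makes the gain `δ * d ^ 2 *
  -- α` exceed the cost `ξ * (δ * d) ^ 2 * β`; the second keeps the speed below `Z`.
  obtain ⟨δ, hδ0, hδ⟩ := exists_between
    (lt_min (div_pos hα (mul_pos hξ hβ)) (div_pos hM.Z_pos hdabs))
  have hδ1 : δ * (M.ξ * β) < α :=
    (lt_div_iff₀ (mul_pos hξ hβ)).1 (hδ.trans_le (min_le_left _ _))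
  have hδ2 : δ * |d| < M.Z := (lt_div_iff₀ hdabs).1 (hδ.trans_le (min_le_right _ _))
  have h1 := h.wealthVar_nonpos (hM.isControl_const (φ := 0) (ψ := δ * d)
    ⟨le_rfl, hM.C_pos.le⟩ (by rw [abs_mul, abs_of_pos hδ0]; exact hδ2.le)) hM hW
  rw [wealthVar_zero_const, ← hd_def, ← hα_def, ← hβ_def] at h1
  have h2 : 0 < d * (δ * d) * α - M.ξ * (δ * d) ^ 2 * β := by
    have : d * (δ * d) * α - M.ξ * (δ * d) ^ 2 * β = δ * d ^ 2 * (α - δ * (M.ξ * β)) := by ring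
    rw [this]
    have : 0 < d ^ 2 := by positivity
    have : 0 < α - δ * (M.ξ * β) := by linarith
    positivity
  exact absurd h1 (not_le.2 (mul_pos (Real.exp_pos _) h2))

/-- Dropping consumption while keeping `z` changes final wealth to first order by a positive
multiple of the discounted integral of `c`. That cannot be positive, so `c = 0` a.e. and only the
disutility of relocation remains. -/
lemma IsOptimalControl.integral_payoff_nonpos (h : M.IsOptimalControl c z) (hM : M.Standing)
    (hW : M.wealth c z M.T = 0) : ∫ t in (0 : ℝ)..M.T, M.payoff c z t ≤ 0 := by
  have hT := hM.T_nonneg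
  have hc := h.isControl
  have h0 : M.IsControl (fun _ => 0) z :=
    ⟨aemeasurable_const, hc.z_meas, fun _ _ => ⟨le_rfl, hM.C_pos.le⟩, hc.z_mem⟩
  have h1 := h.wealthVar_nonpos h0 hM hW
  have hnn : ∀ s ∈ Ioc 0 M.T, 0 ≤ M.flowVar c z (fun _ => 0) z s := fun s hs => by
    have := (hc.c_mem s ⟨hs.1.le, hs.2⟩).1
    have := hM.p_pos
    simp only [flowVar, sub_self, mul_zero, zero_sub, sub_zero, mul_neg, neg_neg]
    positivity
  have hnn' : 0 ≤ᵐ[volume.restrict (Ioc 0 M.T)] M.flowVar c z (fun _ => 0) z := by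
    filter_upwards [ae_restrict_mem measurableSet_Ioc] with s hs using hnn s hs
  have h2 : ∫ s in (0 : ℝ)..M.T, M.flowVar c z (fun _ => 0) z s = 0 := by
    refine le_antisymm ?_ (intervalIntegral.integral_nonneg_of_ae_restrict hT ?_)
    · by_contra! h3
      exact absurd h1 (not_le.2 (mul_pos (Real.exp_pos _) h3))
    · rwa [← restrict_Ioc_eq_restrict_Icc]
  rw [intervalIntegral.integral_eq_zero_iff_of_le_of_nonneg_ae hT hnn'
    (hc.integrable_flowVar h0 hM)] at h2
  rw [intervalIntegral.integral_of_le hT]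
  refine integral_nonpos_of_ae ?_
  filter_upwards [h2, ae_restrict_mem measurableSet_Ioc] with s hs hsT
  have hcs : c s = 0 := by
    simpa [flowVar, hM.p_pos.ne'] using hs
  have hθ : 1 - M.θ ≠ 0 := by linarith [hM.θ_mem.2]
  have := hM.η_pos
  simp only [payoff, hcs, Real.zero_rpow hθ, zero_div, zero_sub, mul_neg, Pi.zero_apply,
    Left.neg_nonpos_iff]
  positivity

/-- Optimal controls leave a positive final wealth. -/
lemma IsOptimalControl.wealth_pos (h : M.IsOptimalControl c z) (hM : M.Standing) :
    0 < M.wealth c z M.T := by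
  refine lt_of_le_of_ne h.wealth_nonneg fun hW => ?_
  have hθ : 0 < 1 - M.θ := by linarith [hM.θ_mem.2]
  have hk : 0 < Real.exp (-M.ρ * M.T) / (1 - M.θ) := by positivity
  have hval : M.value c z ≤ 0 := by
    rw [value, ← hW, Real.zero_rpow hθ.ne', mul_zero, add_zero]
    exact h.integral_payoff_nonpos hM hW.symm
  have h0 : M.IsControl (fun _ => 0) (fun _ => 0) :=
    hM.isControl_const ⟨le_rfl, hM.C_pos.le⟩ (by simpa using hM.Z_pos.le)
  have hW0 : 0 ≤ M.wealth (fun _ => 0) (fun _ => 0) M.T := by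
    rw [wealth_zero]
    have := hM.a₀_nonneg
    have := (integral_discount_pos hM).le
    have := hM.w_nonneg hM.x₀_mem
    positivity
  have hv0 : 0 ≤ M.value (fun _ => 0) (fun _ => 0) := by
    rw [value_zero hM]; positivity
  have hv1 := h.value_le _ _ h0 hW0
  -- Doing nothing has value at least `0`, hence is optimal too; positive final wealth would make
  -- its value positive, contradicting `hval`.
  refine not_isOptimalControl_zero hM ?_
    ⟨h0, hW0, fun c' z' hc' hW' => (h.value_le c' z' hc' hW').trans (hval.trans hv0)⟩
  by_contra hne
  have : 0 < M.value (fun _ => 0) (fun _ => 0) := by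
    rw [value_zero hM]
    exact mul_pos hk (Real.rpow_pos_of_pos (lt_of_le_of_ne hW0 (Ne.symm hne)) _)
  linarith

/-! ### Costates and the maximum principle in normal form. -/

/-- The costate of assets. -/
noncomputable def assetCostate (M : RelocationModel) (l₁ t : ℝ) : ℝ := l₁ * Real.exp (-M.r * t)

/-- The costate of location along the trajectory of `z`. -/
noncomputable def locationCostate (M : RelocationModel) (z : ℝ → ℝ) (l₁ t : ℝ) : ℝ :=
  (∫ s in (0 : ℝ)..M.T, M.assetCostate l₁ s * deriv M.w (M.traj z s)) +
    ∫ s in (0 : ℝ)..t, -(M.assetCostate l₁ s) * deriv M.w (M.traj z s)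

lemma contDiff_assetCostate (l₁ : ℝ) : ContDiff ℝ 1 (M.assetCostate l₁) := by
  unfold assetCostate; fun_prop

lemma hasDerivAt_assetCostate (l₁ t : ℝ) :
    HasDerivAt (M.assetCostate l₁) (-M.r * M.assetCostate l₁ t) t := by
  have h1 : HasDerivAt (fun t => Real.exp (-M.r * t)) (Real.exp (-M.r * t) * -M.r) t := by
    simpa using ((hasDerivAt_id t).const_mul (-M.r)).exp
  refine (h1.const_mul l₁).congr_deriv ?_
  rw [assetCostate]; ring

lemma IsControl.integrable_locationCostate_deriv (h : M.IsControl c z) (hM : M.Standing)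
    (l₁ : ℝ) : IntervalIntegrable
      (fun s => -(M.assetCostate l₁ s) * deriv M.w (M.traj z s)) volume 0 M.T :=
  ((contDiff_assetCostate l₁).continuous.neg.continuousOn.mul
    (hM.continuous_deriv_w.comp_continuousOn
      (h.traj_continuousOn hM.T_nonneg))).intervalIntegrable

lemma IsControl.locationCostate_ac (h : M.IsControl c z) (hM : M.Standing) (l₁ : ℝ) :
    AbsolutelyContinuousOnInterval (M.locationCostate z l₁) 0 M.T :=
  absolutelyContinuousOnInterval_const_add_integral (h.integrable_locationCostate_deriv hM l₁) _

lemma IsControl.ae_hasDerivAt_locationCostate (h : M.IsControl c z) (hM : M.Standing) (l₁ : ℝ) :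
    ∀ᵐ t ∂(volume.restrict (Icc 0 M.T)), HasDerivAt (M.locationCostate z l₁)
      (-(M.assetCostate l₁ t) * deriv M.w (M.traj z t)) t :=
  ae_hasDerivAt_const_add_integral hM.T_nonneg (h.integrable_locationCostate_deriv hM l₁) _

lemma locationCostate_final (z : ℝ → ℝ) (l₁ : ℝ) : M.locationCostate z l₁ M.T = 0 := by
  simp [locationCostate]

/-- The derivative of the product of the location costate with the variation of location. -/
noncomputable def costateFlux (M : RelocationModel) (l₁ : ℝ) (z z' : ℝ → ℝ) (t : ℝ) : ℝ :=
  -(M.assetCostate l₁ t) * deriv M.w (M.traj z t) * (M.traj z' t - M.traj z t) +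
    M.locationCostate z l₁ t * (z' t - z t)

/-- The product being differentiated vanishes at `0`, where both trajectories start at `x₀`, and at
`T`, where the costate is zero. -/
lemma IsControl.integral_costateFlux (h : M.IsControl c z) (h' : M.IsControl c' z')
    (hM : M.Standing) (l₁ : ℝ) : ∫ t in (0 : ℝ)..M.T, M.costateFlux l₁ z z' t = 0 := by
  have hT := hM.T_nonneg
  have h1 := (h.locationCostate_ac hM l₁).fun_mul ((h'.traj_ac hT).fun_sub (h.traj_ac hT))
  have h2 : ∀ᵐ t ∂(volume.restrict (Icc 0 M.T)), HasDerivAt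
      (fun t => M.locationCostate z l₁ t * (M.traj z' t - M.traj z t))
      (M.costateFlux l₁ z z' t) t := by
    filter_upwards [h.ae_hasDerivAt_locationCostate hM l₁,
      ae_hasDerivAt_const_add_integral hT (h.integrable_z hT) M.x₀,
      ae_hasDerivAt_const_add_integral hT (h'.integrable_z hT) M.x₀] with t ht1 ht2 ht3
    exact ht1.mul (ht3.sub ht2)
  have h3 := h1.eq_add_integral h2 (right_mem_Icc.2 hT)
  rw [locationCostate_final] at h3
  simpa [traj] using h3.symm

lemma IsControl.integrable_costateFlux (h : M.IsControl c z) (h' : M.IsControl c' z')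
    (hM : M.Standing) (l₁ : ℝ) : IntervalIntegrable (M.costateFlux l₁ z z') volume 0 M.T := by
  have hT := hM.T_nonneg
  exact ((h.integrable_locationCostate_deriv hM l₁).mul_continuousOn
      ((h'.traj_continuousOn hT).sub (h.traj_continuousOn hT))).add
    (((h'.integrable_z hT).sub (h.integrable_z hT)).continuousOn_mul
      (h.locationCostate_ac hM l₁).continuousOn)

/-- The gain in the normal Hamiltonian when `(c, z)` is replaced by `(c', z')`. -/
noncomputable def hamiltonianGain (M : RelocationModel) (l₁ : ℝ) (c z c' z' : ℝ → ℝ) (t : ℝ) :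
    ℝ :=
  M.payoff c' z' t - M.payoff c z t + l₁ * M.flowVar c z c' z' t + M.costateFlux l₁ z z' t

lemma IsControl.integrable_hamiltonianGain (h : M.IsControl c z) (h' : M.IsControl c' z')
    (hM : M.Standing) (l₁ : ℝ) :
    IntervalIntegrable (M.hamiltonianGain l₁ c z c' z') volume 0 M.T :=
  (((h'.integrable_payoff hM).sub (h.integrable_payoff hM)).add
    ((h.integrable_flowVar h' hM).const_mul l₁)).add (h.integrable_costateFlux h' hM l₁)

/-- The `deriv w` terms of `flowVar` and `costateFlux` cancel, so the gain depends on the competitor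
only through its controls at time `t`. The state terms cancel as well, hence the free `A` and `X`.
-/
lemma hamiltonianGain_eq (l₁ : ℝ) (c z c' z' : ℝ → ℝ) (t A X : ℝ) :
    M.hamiltonianGain l₁ c z c' z' t =
      M.hamiltonian 1 t A X (c' t) (z' t) (M.assetCostate l₁ t) (M.locationCostate z l₁ t) -
      M.hamiltonian 1 t A X (c t) (z t) (M.assetCostate l₁ t) (M.locationCostate z l₁ t) := by
  rw [hamiltonianGain, payoff, payoff, flowVar, costateFlux, hamiltonian, hamiltonian,
    assetCostate]
  ring

/-- The shadow price of initial assets at final wealth `W`. -/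
noncomputable def shadowPrice (M : RelocationModel) (W : ℝ) : ℝ :=
  Real.exp (-M.ρ * M.T) * W ^ (-M.θ) * Real.exp (M.r * M.T)

lemma IsOptimalControl.integral_hamiltonianGain_nonpos (h : M.IsOptimalControl c z)
    (h' : M.IsControl c' z') (hM : M.Standing) :
    ∫ t in (0 : ℝ)..M.T,
      M.hamiltonianGain (M.shadowPrice (M.wealth c z M.T)) c z c' z' t ≤ 0 := by
  have hc := h.isControl
  have i1 := (h'.integrable_payoff hM).sub (hc.integrable_payoff hM)
  have i2 := (hc.integrable_flowVar h' hM).const_mul (M.shadowPrice (M.wealth c z M.T))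
  have h1 := h.variation_nonpos h' hM (h.wealth_pos hM)
  simp only [hamiltonianGain]
  rw [intervalIntegral.integral_add (i1.add i2) (hc.integrable_costateFlux h' hM _),
    intervalIntegral.integral_add i1 i2, intervalIntegral.integral_const_mul,
    hc.integral_costateFlux h' hM, add_zero]
  rw [wealthVar, ← mul_assoc] at h1
  exact h1

/-- The consumption maximizing the normal Hamiltonian. -/
noncomputable def bestConsumption (M : RelocationModel) (l₁ t : ℝ) : ℝ :=
  min M.C ((Real.exp (-M.ρ * t) / (M.p * M.assetCostate l₁ t)) ^ (1 / M.θ))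

/-- The relocation speed maximizing the normal Hamiltonian. -/
noncomputable def bestSpeed (M : RelocationModel) (z : ℝ → ℝ) (l₁ t : ℝ) : ℝ :=
  max (-M.Z) (min M.Z (M.locationCostate z l₁ t /
    (2 * (M.assetCostate l₁ t * M.ξ + Real.exp (-M.ρ * t) * M.η))))

/-- Strictness, with an arbitrary location costate `P`, is what later determines consumption from
any multipliers. -/
lemma Standing.hamiltonian_lt (hM : M.Standing) {l₁ t A X φ ψ P : ℝ} (hl : 0 < l₁)
    (hφ : φ ∈ Icc 0 M.C) (hne : φ ≠ M.bestConsumption l₁ t) :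
    M.hamiltonian 1 t A X φ ψ (M.assetCostate l₁ t) P <
      M.hamiltonian 1 t A X (M.bestConsumption l₁ t) ψ (M.assetCostate l₁ t) P := by
  have hq : 0 < M.p * M.assetCostate l₁ t :=
    mul_pos hM.p_pos (mul_pos hl (Real.exp_pos _))
  have h1 := utility_lt_of_ne hM.θ_mem (Real.exp_pos (-M.ρ * t)) hq hM.C_pos hφ hne
  rw [← bestConsumption] at h1
  rw [hamiltonian, hamiltonian]
  linarith

lemma Standing.hamiltonian_le (hM : M.Standing) {l₁ t A X φ ψ : ℝ} (hl : 0 < l₁)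
    (hφ : φ ∈ Icc 0 M.C) (hψ : ψ ∈ Icc (-M.Z) M.Z) :
    M.hamiltonian 1 t A X φ ψ (M.assetCostate l₁ t) (M.locationCostate z l₁ t) ≤
      M.hamiltonian 1 t A X (M.bestConsumption l₁ t) (M.bestSpeed z l₁ t)
        (M.assetCostate l₁ t) (M.locationCostate z l₁ t) := by
  have h1 : M.hamiltonian 1 t A X φ ψ (M.assetCostate l₁ t) (M.locationCostate z l₁ t) ≤
      M.hamiltonian 1 t A X (M.bestConsumption l₁ t) ψ (M.assetCostate l₁ t)
        (M.locationCostate z l₁ t) := by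
    rcases eq_or_ne φ (M.bestConsumption l₁ t) with h | h
    · rw [h]
    · exact (hM.hamiltonian_lt hl hφ h).le
  have hb : 0 < M.assetCostate l₁ t * M.ξ + Real.exp (-M.ρ * t) * M.η :=
    add_pos (mul_pos (mul_pos hl (Real.exp_pos _)) hM.ξ_pos)
      (mul_pos (Real.exp_pos _) hM.η_pos)
  have h2 := parabola_le_clip (P := M.locationCostate z l₁ t) hb hψ
  rw [← bestSpeed] at h2
  refine h1.trans ?_
  rw [hamiltonian, hamiltonian]
  linarith

lemma IsControl.isControl_best (h : M.IsControl c z) (hM : M.Standing) {l₁ : ℝ} (hl : 0 < l₁) :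
    M.IsControl (M.bestConsumption l₁) (M.bestSpeed z l₁) where
  c_meas := by
    have h1 := (contDiff_assetCostate (M := M) l₁).continuous.measurable
    have : Measurable (M.bestConsumption l₁) := by
      unfold bestConsumption
      fun_prop
    exact this.aemeasurable
  z_meas := by
    have h1 := (contDiff_assetCostate (M := M) l₁).continuous.measurable
    have h2 : AEMeasurable (M.locationCostate z l₁) (volume.restrict (Icc 0 M.T)) := by
      have := (h.locationCostate_ac hM l₁).continuousOn
      rw [uIcc_of_le hM.T_nonneg] at this
      exact this.aemeasurable measurableSet_Icc
    unfold bestSpeed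
    fun_prop
  c_mem t _ := by
    have : 0 < M.p * M.assetCostate l₁ t := mul_pos hM.p_pos (mul_pos hl (Real.exp_pos _))
    exact ⟨le_min hM.C_pos.le (by positivity), min_le_left _ _⟩
  z_mem t _ := abs_le.2 ⟨le_max_left _ _,
    max_le (by linarith [hM.Z_pos]) (min_le_left _ _)⟩

lemma IsOptimalControl.shadowPrice_pos (h : M.IsOptimalControl c z) (hM : M.Standing) :
    0 < M.shadowPrice (M.wealth c z M.T) :=
  mul_pos (mul_pos (Real.exp_pos _) (Real.rpow_pos_of_pos (h.wealth_pos hM) _)) (Real.exp_pos _)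

/-- Against the pointwise maximizer the gain is nonnegative, while optimality makes its integral
nonpositive. -/
lemma IsOptimalControl.ae_hamiltonianGain_eq_zero (h : M.IsOptimalControl c z)
    (hM : M.Standing) : ∀ᵐ t ∂(volume.restrict (Icc 0 M.T)),
      M.hamiltonianGain (M.shadowPrice (M.wealth c z M.T)) c z
        (M.bestConsumption (M.shadowPrice (M.wealth c z M.T)))
        (M.bestSpeed z (M.shadowPrice (M.wealth c z M.T))) t = 0 := by
  have hT := hM.T_nonneg
  have hl := h.shadowPrice_pos hM
  have hc := h.isControl
  have hbest := hc.isControl_best hM hl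
  set l₁ := M.shadowPrice (M.wealth c z M.T) with hl_def
  have h1 := h.integral_hamiltonianGain_nonpos hbest hM
  rw [← hl_def] at h1
  have hnn : 0 ≤ᵐ[volume.restrict (Ioc 0 M.T)] M.hamiltonianGain l₁ c z
      (M.bestConsumption l₁) (M.bestSpeed z l₁) := by
    filter_upwards [ae_restrict_mem measurableSet_Ioc] with t ht
    have ht' : t ∈ Icc 0 M.T := ⟨ht.1.le, ht.2⟩
    rw [Pi.zero_apply, hamiltonianGain_eq l₁ _ _ _ _ t 0 0, sub_nonneg]
    exact hM.hamiltonian_le hl (hc.c_mem t ht') (abs_le.1 (hc.z_mem t ht'))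
  have h2 : ∫ t in (0 : ℝ)..M.T, M.hamiltonianGain l₁ c z
      (M.bestConsumption l₁) (M.bestSpeed z l₁) t = 0 := by
    refine le_antisymm h1 (intervalIntegral.integral_nonneg_of_ae_restrict hT ?_)
    rwa [← restrict_Ioc_eq_restrict_Icc]
  rw [intervalIntegral.integral_eq_zero_iff_of_le_of_nonneg_ae hT hnn
    (hc.integrable_hamiltonianGain hbest hM l₁), restrict_Ioc_eq_restrict_Icc] at h2
  exact h2

/-- The maximum principle in normal form. -/
lemma IsOptimal.isMultiplier (hM : M.Standing) (h : M.IsOptimal c z a x) :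
    M.IsMultiplier c z a x 1 (M.assetCostate (M.shadowPrice (a M.T)))
      (M.locationCostate z (M.shadowPrice (a M.T))) := by
  have hopt := h.isOptimalControl hM
  have haT := h.1.eq_wealth (right_mem_Icc.2 hM.T_nonneg)
  have hl := hopt.shadowPrice_pos hM
  have hgain := hopt.ae_hamiltonianGain_eq_zero hM
  rw [← haT] at hl hgain
  have hc := hopt.isControl
  exact
  { l₀_mem := Or.inr rfl
    p₁_ac := AbsolutelyContinuousOnInterval.of_contDiff (contDiff_assetCostate _) _ _
    p₂_ac := hc.locationCostate_ac hM _
    p₁_ode := Filter.Eventually.of_forall fun t => hasDerivAt_assetCostate _ t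
    p₂_ode := by
      filter_upwards [hc.ae_hasDerivAt_locationCostate hM (M.shadowPrice (a M.T)),
        ae_restrict_mem measurableSet_Icc] with t ht htT
      rwa [h.1.eq_traj htT]
    maximum := by
      filter_upwards [hgain] with t ht φ hφ ψ hψ
      rw [hamiltonianGain_eq _ _ _ _ _ t (a t) (x t), sub_eq_zero] at ht
      rw [← ht]
      exact hM.hamiltonian_le hl hφ hψ
    p₁_final := by
      rw [assetCostate, shadowPrice, mul_assoc, ← Real.exp_add]
      simp
    p₂_final := locationCostate_final _ _
    nontrivial := fun h => one_ne_zero h.1 }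

end RelocationModel

/-! ### Consequences for arbitrary multipliers. -/

namespace RelocationModel

variable {M : RelocationModel} {c z a x : ℝ → ℝ} {l₀ : ℝ} {p₁ p₂ : ℝ → ℝ}

namespace IsMultiplier

lemma p₁_eq (h : M.IsMultiplier c z a x l₀ p₁ p₂) {t : ℝ} (ht : t ∈ Icc 0 M.T) :
    p₁ t = M.assetCostate (p₁ 0) t := by
  have h1 : AbsolutelyContinuousOnInterval (fun s => Real.exp (M.r * s) * p₁ s) 0 M.T :=
    (AbsolutelyContinuousOnInterval.of_contDiff
      (by fun_prop : ContDiff ℝ 1 fun t => Real.exp (M.r * t)) 0 M.T).fun_mul h.p₁_ac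
  have h2 : ∀ᵐ s ∂(volume.restrict (Icc 0 M.T)),
      HasDerivAt (fun s => Real.exp (M.r * s) * p₁ s) 0 s := by
    filter_upwards [h.p₁_ode] with s hs
    have h1 : HasDerivAt (fun t => Real.exp (M.r * t)) (Real.exp (M.r * s) * M.r) s := by
      simpa using ((hasDerivAt_id s).const_mul M.r).exp
    refine (h1.mul hs).congr_deriv ?_
    ring
  have h3 := h1.eq_add_integral h2 ht
  simp only [mul_zero, Real.exp_zero, one_mul, intervalIntegral.integral_zero, add_zero] at h3
  rw [assetCostate, ← h3, mul_right_comm, ← Real.exp_add]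
  simp

/-- If `l₀ = 0`, then `p₁ T = 0`, so `p₁` vanishes identically. Then `p₂` is constant with final
value zero, contradicting nontriviality. -/
lemma l₀_eq_one (h : M.IsMultiplier c z a x l₀ p₁ p₂) (hT : 0 ≤ M.T) : l₀ = 1 := by
  refine h.l₀_mem.resolve_left fun h0 => h.nontrivial ⟨h0, ?_⟩
  have hTT : M.T ∈ Icc 0 M.T := right_mem_Icc.2 hT
  have h1 : p₁ 0 = 0 := by
    have h1 := h.p₁_final
    rw [h.p₁_eq hTT, h0, zero_mul, zero_mul, assetCostate] at h1
    exact (mul_eq_zero.1 h1).resolve_right (Real.exp_pos _).ne'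
  have h2 : ∀ t ∈ Icc 0 M.T, p₁ t = 0 := fun t ht => by
    rw [h.p₁_eq ht, assetCostate, h1, zero_mul]
  have h3 : ∀ᵐ t ∂(volume.restrict (Icc 0 M.T)), HasDerivAt p₂ 0 t := by
    filter_upwards [h.p₂_ode, ae_restrict_mem measurableSet_Icc] with t ht htT
    simpa [h2 t htT] using ht
  have h4 : ∀ t ∈ Icc 0 M.T, p₂ t = p₂ 0 := fun t ht => by
    simpa using h.p₂_ac.eq_add_integral h3 ht
  exact fun t ht => ⟨h2 t ht, by rw [h4 t ht, ← h4 _ hTT, h.p₂_final]⟩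

lemma p₁_zero_eq (h : M.IsMultiplier c z a x l₀ p₁ p₂) (hT : 0 ≤ M.T) :
    p₁ 0 = M.shadowPrice (a M.T) := by
  have h1 := h.p₁_final
  rw [h.p₁_eq (right_mem_Icc.2 hT), h.l₀_eq_one hT, assetCostate, one_mul] at h1
  rw [shadowPrice, ← h1, mul_assoc, ← Real.exp_add]
  simp

lemma ae_eq_bestConsumption (h : M.IsMultiplier c z a x l₀ p₁ p₂) (hM : M.Standing)
    (hc : M.IsControl c z) (hl : 0 < p₁ 0) :
    ∀ᵐ t ∂(volume.restrict (Icc 0 M.T)), c t = M.bestConsumption (p₁ 0) t := by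
  filter_upwards [h.maximum, ae_restrict_mem measurableSet_Icc] with t ht htT
  by_contra hne
  -- The speed is kept at `z t`, so only the consumption terms are compared.
  have h1 := ht _ ((hc.isControl_best hM hl).c_mem t htT) (z t) (abs_le.1 (hc.z_mem t htT))
  rw [h.l₀_eq_one hM.T_nonneg, h.p₁_eq htT] at h1
  exact absurd h1 (not_le.2 (hM.hamiltonian_lt hl (hc.c_mem t htT) hne))

end IsMultiplier

/-! ### The closed-form rule and the inactive upper bound. -/

lemma bestConsumption_eq (hM : M.Standing) {l : ℝ} (hl : 0 < l) (t : ℝ) :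
    M.bestConsumption l t = min M.C (M.ruleMultiplier l t) := by
  have hp := hM.p_pos
  rw [bestConsumption, ruleMultiplier]
  congr 1
  have h1 : Real.exp (-M.ρ * t) / (M.p * M.assetCostate l t) =
      1 / (M.p * l) * Real.exp ((M.r - M.ρ) * t) := by
    rw [assetCostate, show (M.r - M.ρ) * t = -M.ρ * t - -M.r * t by ring, Real.exp_sub]
    field_simp
  rw [h1, Real.mul_rpow (by positivity) (Real.exp_pos _).le, ← Real.exp_mul]
  congr 2
  ring

lemma ruleMultiplier_shadowPrice (hM : M.Standing) {W : ℝ} (hW : 0 < W) (t : ℝ) :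
    M.ruleMultiplier (M.shadowPrice W) t = M.ruleAssets W t := by
  have hp := hM.p_pos
  have hθ := hM.θ_mem.1.ne'
  have h1 : 1 / (M.p * M.shadowPrice W) =
      1 / M.p * (W ^ M.θ * Real.exp ((M.ρ - M.r) * M.T)) := by
    rw [shadowPrice, Real.rpow_neg hW.le,
      show (M.ρ - M.r) * M.T = -(-M.ρ * M.T + M.r * M.T) by ring, Real.exp_neg, Real.exp_add]
    have := Real.rpow_pos_of_pos hW M.θ
    field_simp
  rw [ruleMultiplier, ruleAssets, h1, Real.mul_rpow (by positivity) (by positivity),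
    Real.mul_rpow (by positivity) (by positivity), ← Real.rpow_mul hW.le, mul_one_div_cancel hθ,
    Real.rpow_one, ← Real.exp_mul, Real.div_rpow zero_le_one hp.le, Real.one_rpow,
    show (M.ρ - M.r) / M.θ * (M.T - t) =
      (M.ρ - M.r) * M.T * (1 / M.θ) + (M.r - M.ρ) / M.θ * t by ring, Real.exp_add]
  ring

lemma exp_le_mu {t t₀ : ℝ} (ht : t ∈ Icc 0 M.T) (ht₀ : t₀ ∈ Icc 0 M.T) :
    Real.exp ((M.r - M.ρ) * (t - t₀)) ≤ M.mu := by
  refine le_csSup ?_ ⟨(t, t₀), ⟨ht, ht₀⟩, rfl⟩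
  exact ((isCompact_Icc.prod isCompact_Icc).image
    (by fun_prop : Continuous fun q : ℝ × ℝ =>
      Real.exp ((M.r - M.ρ) * (q.1 - q.2)))).bddAbove

/-- The values at two times differ by the factor `exp ((r - ρ) * (t₀ - t)) ^ (1 / θ)`. -/
lemma ruleMultiplier_le (hM : M.Standing) {l t t₀ : ℝ} (hl : 0 < l) (ht : t ∈ Icc 0 M.T)
    (ht₀ : t₀ ∈ Icc 0 M.T) :
    M.ruleMultiplier l t₀ ≤ M.mu ^ (1 / M.θ) * M.ruleMultiplier l t := by
  have hθ := hM.θ_mem.1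
  have hp := hM.p_pos
  have h1 : M.ruleMultiplier l t₀ =
      Real.exp ((M.r - M.ρ) * (t₀ - t)) ^ (1 / M.θ) * M.ruleMultiplier l t := by
    rw [ruleMultiplier, ruleMultiplier, ← Real.exp_mul,
      show (M.r - M.ρ) / M.θ * t₀ =
        (M.r - M.ρ) * (t₀ - t) * (1 / M.θ) + (M.r - M.ρ) / M.θ * t by ring, Real.exp_add]
    ring
  rw [h1]
  have h2 : 0 ≤ M.ruleMultiplier l t := by
    rw [ruleMultiplier]; positivity
  exact mul_le_mul_of_nonneg_right (Real.rpow_le_rpow (Real.exp_pos _).le (exp_le_mu ht₀ ht)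
    (by positivity)) h2

lemma integral_discount (hM : M.Standing) :
    ∫ s in (0 : ℝ)..M.T, Real.exp (-M.r * s) = (1 - Real.exp (-M.r * M.T)) / M.r := by
  have hr := hM.r_pos.ne'
  rw [intervalIntegral.integral_comp_mul_left (fun s => Real.exp s) (neg_ne_zero.2 hr),
    integral_exp, smul_eq_mul, mul_zero, Real.exp_zero]
  field_simp
  ring

/-- A uniform lower bound on consumption that exhausts all resources leaves a debt. -/
lemma IsControl.lt_of_wealth_pos (hc : M.IsControl c z) (hM : M.Standing)
    (hW : 0 < M.wealth c z M.T) {k : ℝ}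
    (hk : ∀ᵐ t ∂(volume.restrict (Icc 0 M.T)), k ≤ c t) :
    k * (M.p * ((1 - Real.exp (-M.r * M.T)) / M.r)) < M.a₀ + M.T * ⨆ x, |M.w x| := by
  set S := ⨆ x, |M.w x| with hS
  have hS0 : 0 ≤ S := Real.iSup_nonneg fun x => abs_nonneg _
  have i1 : IntervalIntegrable (fun s => M.p * k * Real.exp (-M.r * s)) volume 0 M.T :=
    (by fun_prop : Continuous fun s => M.p * k * Real.exp (-M.r * s)).intervalIntegrable _ _
  have h1 : ∫ s in (0 : ℝ)..M.T, M.flow c z s ≤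
      ∫ s in (0 : ℝ)..M.T, (S - M.p * k * Real.exp (-M.r * s)) := by
    refine intervalIntegral.integral_mono_ae_restrict hM.T_nonneg (hc.integrable_flow hM)
      (intervalIntegrable_const.sub i1) ?_
    filter_upwards [hk, ae_restrict_mem measurableSet_Icc] with s hs hsT
    have hE0 := Real.exp_pos (-M.r * s)
    have hE1 : Real.exp (-M.r * s) ≤ 1 := by
      rw [Real.exp_le_one_iff]; nlinarith [hM.r_pos, hsT.1]
    have h2 : M.w (M.traj z s) ≤ S := (le_abs_self _).trans (le_ciSup hM.w_bdd _)
    -- Income is bounded without its discount factor, which produces `T * S`; the discount is kept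
    -- on consumption and produces the annuity factor.
    have h3 : Real.exp (-M.r * s) * S ≤ S := mul_le_of_le_one_left hS0 hE1
    have h4 : 0 ≤ M.ξ * z s ^ 2 := mul_nonneg hM.ξ_pos.le (sq_nonneg _)
    have h5 := mul_le_mul_of_nonneg_left hs hM.p_pos.le
    have h6 := mul_le_mul_of_nonneg_left
      (by linarith : M.w (M.traj z s) - M.p * c s - M.ξ * z s ^ 2 ≤ S - M.p * k) hE0.le
    rw [flow]
    linarith
  rw [intervalIntegral.integral_sub intervalIntegrable_const i1,
    intervalIntegral.integral_const, intervalIntegral.integral_const_mul, integral_discount hM,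
    smul_eq_mul, sub_zero] at h1
  have h2 : 0 < M.a₀ + ∫ s in (0 : ℝ)..M.T, M.flow c z s :=
    (mul_pos_iff_of_pos_left (Real.exp_pos _)).1 hW
  linarith

/-- If the rule reached `C` at `t₀`, consumption would be at least `C / m` a.e., and positive final
wealth would then contradict `C_large`. -/
lemma IsMultiplier.ruleMultiplier_lt (h : M.IsMultiplier c z a x l₀ p₁ p₂) (hM : M.Standing)
    (hc : M.IsControl c z) (hW : 0 < M.wealth c z M.T) (hl : 0 < p₁ 0) {t₀ : ℝ}
    (ht₀ : t₀ ∈ Icc 0 M.T) : M.ruleMultiplier (p₁ 0) t₀ < M.C := by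
  by_contra! hC
  set m := max 1 (M.mu ^ (1 / M.θ)) with hm
  have hm1 : 1 ≤ m := le_max_left _ _
  have hm0 : 0 < m := by linarith
  have hk : ∀ᵐ t ∂(volume.restrict (Icc 0 M.T)), M.C / m ≤ c t := by
    filter_upwards [h.ae_eq_bestConsumption hM hc hl, ae_restrict_mem measurableSet_Icc]
      with t ht htT
    rw [ht, bestConsumption_eq hM hl, le_min_iff, div_le_iff₀ hm0, div_le_iff₀ hm0]
    refine ⟨le_mul_of_one_le_right hM.C_pos.le hm1, ?_⟩
    have h2 : 0 ≤ M.ruleMultiplier (p₁ 0) t := by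
      have := hM.p_pos
      rw [ruleMultiplier]; positivity
    calc M.C ≤ M.mu ^ (1 / M.θ) * M.ruleMultiplier (p₁ 0) t :=
          hC.trans (ruleMultiplier_le hM hl htT ht₀)
      _ ≤ m * M.ruleMultiplier (p₁ 0) t := mul_le_mul_of_nonneg_right (le_max_right _ _) h2
      _ = _ := mul_comm _ _
  have h1 := hc.lt_of_wealth_pos hM hW hk
  rw [← lt_div_iff₀ (mul_pos hM.p_pos hM.annuity_pos), div_lt_iff₀ hm0, mul_comm] at h1
  exact lt_asymm h1 hM.C_large

end RelocationModel

theorem mainTheorem3 (M : RelocationModel) (hM : M.Standing) (c z a x : ℝ → ℝ)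
    (hopt : M.IsOptimal c z a x) :
    (∃ (l₀ : ℝ) (p₁ p₂ : ℝ → ℝ), M.IsMultiplier c z a x l₀ p₁ p₂) ∧
    ∀ (l₀ : ℝ) (p₁ p₂ : ℝ → ℝ), M.IsMultiplier c z a x l₀ p₁ p₂ →
      0 < p₁ 0 ∧
      (∀ t ∈ Icc 0 M.T,
        M.ruleMultiplier (p₁ 0) t = M.ruleAssets (a M.T) t ∧
        M.ruleAssets (a M.T) t ∈ Ioo 0 M.C) ∧
      (∀ᵐ t ∂(volume.restrict (Icc 0 M.T)),
        c t ∈ Ioo 0 M.C ∧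
        c t = M.ruleMultiplier (p₁ 0) t ∧
        c t = M.ruleAssets (a M.T) t) := by
  refine ⟨⟨_, _, _, hopt.isMultiplier hM⟩, fun l₀ p₁ p₂ h => ?_⟩
  have hopt' := hopt.isOptimalControl hM
  have haT := hopt.1.eq_wealth (right_mem_Icc.2 hM.T_nonneg)
  have hW := hopt'.wealth_pos hM
  have hp₁ := h.p₁_zero_eq hM.T_nonneg
  have hl : 0 < p₁ 0 := by
    rw [hp₁, haT]; exact hopt'.shadowPrice_pos hM
  have hrule : ∀ t ∈ Icc 0 M.T, M.ruleMultiplier (p₁ 0) t = M.ruleAssets (a M.T) t ∧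
      M.ruleAssets (a M.T) t ∈ Ioo 0 M.C := fun t ht => by
    have h1 : M.ruleMultiplier (p₁ 0) t = M.ruleAssets (a M.T) t := by
      rw [hp₁]; exact RelocationModel.ruleMultiplier_shadowPrice hM (haT ▸ hW) t
    have h2 : 0 < M.ruleMultiplier (p₁ 0) t := by
      have := hM.p_pos
      rw [RelocationModel.ruleMultiplier]; positivity
    exact ⟨h1, h1 ▸ h2, h1 ▸ h.ruleMultiplier_lt hM hopt'.isControl hW hl ht⟩
  refine ⟨hl, hrule, ?_⟩
  filter_upwards [h.ae_eq_bestConsumption hM hopt'.isControl hl,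
    ae_restrict_mem measurableSet_Icc] with t ht htT
  obtain ⟨h1, h2⟩ := hrule t htT
  rw [RelocationModel.bestConsumption_eq hM hl, h1, min_eq_right h2.2.le] at ht
  exact ⟨ht ▸ h2, ht.trans h1.symm, ht⟩
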